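/- **Setting.** Let $E$ be a set and let $\lambda : 2^E\to\mathbb N\cup\{\infty\}$ be symmetric ($\lambda(A)=\lambda(E\setminus A)$), submodular ($\lambda(A\cup B)+\lambda(A\cap B)\le\lambda(A)+\lambda(B)$) and limit-closed (for every $n\in\mathbb N$, the union of a non-empty chain of sets of order at most $n$ has order at most $n$), where $\lambda(A)$ is called the *order* of $A$. Let $k\ge 1$ be an integer. *Profiles.* For an integer $l\ge 0$ let $S_l$ be the set of all $A\subseteq E$ of order less than $l$. A $k$-profile is a set $P\subseteq S_k$ such that (i) for every $A\in S_k$, exactly one element of $\{A,E\setminus A\}$ lies in $P$; (ii) there are no $E\setminus A\in P$ and $B\in P$ with $A\subsetneq B$ and $B\neq E\setminus A$; (iii) $E\setminus(A\cup B)\notin P$ for all $A,B\in P$. The truncation of $P$ to $S_{k-1}$ is $P\cap S_{k-1}$. A set $A$ distinguishes $P$ and $P'$ if one of them contains $A$ and the other contains $E\setminus A$. *Pseudo-flowers.* A $k$-pseudo-flower is a partition $\Phi=(P_i)_{i\in I}$ of $E$ into non-empty petals with a cyclically ordered index set $I$ such that the union of the petals of any interval of $I$ has order at most $k-1$. (An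 interval is a subset $J$ of $I$ that for any $x,y\in J$ contains one of the open intervals $]x,y[$, $]y,x[$; it is non-trivial if $\emptyset\ne J\ne I$.) The sets *displayed* by $\Phi$ are the unions of the petals of non-trivial intervals. A concatenation of $\Phi$ is a $k$-pseudo-flower $(Q_i)_{i\in I'}$ for which there is a map $f:I\to I'$ such that $P_i\subseteq Q_{f(i)}$ for all $i\in I$ and preimages of intervals are intervals. A $k$-flower is a $k$-pseudo-flower with at least four petals all of whose displayed sets have order exactly $k-1$. A $k$-anemone is a $k$-flower such that in each of its concatenations with finitely many petals all non-trivial unions of petals (neither no petal nor all petals) have order exactly $k-1$. A strong $k$-pseudo-anemone is a $k$-pseudo-flower all of whose unions of petals have order at most $k-1$. *Pre-orders.* For strong $k$-pseudo-anemones write $\Phi\le_A\Psi$ if the partition of $\Phi$ is coarser than or equal to that of $\Psi$. For a set $\mathcal P$ of $k$-profiles, write $\Phi\preccurlyeq_A\Psi$ for strong $k$-pseudo-anemones if any two profiles in $\mathcal P$ distinguished by a union of petals of $\Phi$ are distinguished by a union of petals of $\Psi$; and write $\Phi\preccurlyeq\Psi$ for $k$-pseudo-flowers if any two profiles in $\mathcal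 P$ distinguished by the union of an interval of $\Phi$ are distinguished by the union of an interval of $\Psi$. An element $\Phi$ is maximal in a pre-order $\sqsubseteq$ if $\Phi\sqsubseteq\Psi$ implies $\Psi\sqsubseteq\Phi$. **Statement.** 1. Let $\mathcal P$ be a set of $k$-profiles that all have the same truncation to $S_{k-1}$. Let $\Phi$ be a $\le_A$-maximal strong $k$-pseudo-anemone that has a concatenation into a $k$-anemone, and suppose that some three elements of $\mathcal P$ are pairwise distinguished by sets displayed by $\Phi$. Then $\Phi$ is $\preccurlyeq_A$-maximal among the strong $k$-pseudo-anemones. 2. In contrast, $\preccurlyeq$-maximal anemones need not exist: let $E$ be any infinite set, $k\ge 2$, let $\lambda(\emptyset)=\lambda(E)=0$ and $\lambda(A)=k-1$ for all other $A\subseteq E$, and let $\mathcal P$ be the set of all $k$-profiles. Then $\lambda$ is symmetric, submodular and limit-closed, all elements of $\mathcal P$ have the same truncation to $S_{k-1}$, there is a $k$-anemone, but no $k$-anemone is $\preccurlyeq$-maximal among the $k$-anemones, and no $k$-pseudo-flower is $\preccurlyeq$-maximal among the $k$-pseudo-flowers. -/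

import Mathlib

universe u

/-- `lam` is the connectivity function of a connectivity system on the ground set `E`:
symmetric, submodular and limit-closed. -/
structure IsConnectivity {E : Type u} (lam : Set E → ℕ∞) : Prop where
  symm : ∀ A : Set E, lam Aᶜ = lam A
  submodular : ∀ A B : Set E, lam (A ∪ B) + lam (A ∩ B) ≤ lam A + lam B
  limit_closed : ∀ (n : ℕ) (C : Set (Set E)), C.Nonempty → IsChain (· ⊆ ·) C →
    (∀ A ∈ C, lam A ≤ (n : ℕ∞)) → lam (⋃₀ C) ≤ (n : ℕ∞)

/-! ### Profiles -/

/-- The separation system `S_k` of all sets of order less than `k`. The inverse of a separation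
`A` is its complement, the order relation is inclusion, and joins are unions. -/
def sepSystem {E : Type u} (lam : Set E → ℕ∞) (k : ℕ) : Set (Set E) :=
  {A | lam A < (k : ℕ∞)}

/-- `O` is an orientation of `S`: a subset of `S` containing exactly one of `A`, `Aᶜ` for every
`A` in `S`. -/
def IsOrientation {E : Type u} (S O : Set (Set E)) : Prop :=
  O ⊆ S ∧ ∀ A ∈ S, ∃! B : Set E, B ∈ O ∩ {A, Aᶜ}

/-- `O` does not contain `Aᶜ` and `B` which are not orientations of each other with `A ⊂ B`. -/
def IsConsistent {E : Type u} (O : Set (Set E)) : Prop :=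
  ¬ ∃ A B : Set E, Aᶜ ∈ O ∧ B ∈ O ∧ B ≠ A ∧ B ≠ Aᶜ ∧ A ⊂ B

/-- `P` is a `k`-profile: a consistent orientation of `S_k` with the profile property. -/
def IsProfile {E : Type u} (lam : Set E → ℕ∞) (k : ℕ) (P : Set (Set E)) : Prop :=
  IsOrientation (sepSystem lam k) P ∧ IsConsistent P ∧
    ∀ A ∈ P, ∀ B ∈ P, (A ∪ B)ᶜ ∉ P

/-- The truncation of a profile to an `l`-profile. -/
def truncation {E : Type u} (lam : Set E → ℕ∞) (l : ℕ) (P : Set (Set E)) : Set (Set E) :=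
  P ∩ sepSystem lam l

/-- The separation `A` distinguishes `P` and `Q`: they contain distinct orientations of it. -/
def Distinguishes {E : Type u} (A : Set E) (P Q : Set (Set E)) : Prop :=
  (A ∈ P ∧ Aᶜ ∈ Q) ∨ (Aᶜ ∈ P ∧ A ∈ Q)

/-! ### Cyclically ordered partitions -/

/-- An interval of a cyclically ordered set: a subset that contains, for any two of its elements,
one of the two open intervals between them. The empty set and the whole set are the trivial
intervals. Intervals need not have end points in the cyclically ordered set. -/
def IsCyclicInterval {I : Type u} [CircularOrder I] (J : Set I) : Prop :=
  ∀ x ∈ J, ∀ y ∈ J, Set.cIoo x y ⊆ J ∨ Set.cIoo y x ⊆ J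

/-- A partition of `E` into non-empty petals whose index set is cyclically ordered. As the petals
are non-empty and disjoint, index sets in the universe of `E` suffice. -/
structure CyclicPartition (E : Type u) where
  Idx : Type u
  circ : CircularOrder Idx
  petal : Idx → Set E
  petal_nonempty : ∀ i, (petal i).Nonempty
  petal_disjoint : ∀ i j, i ≠ j → Disjoint (petal i) (petal j)
  petal_cover : ⋃ i, petal i = Set.univ

attribute [instance] CyclicPartition.circ

namespace CyclicPartition

/-- The union `S(J)` of the petals with index in `J`. -/
def unionOf {E : Type u} (Φ : CyclicPartition E) (J : Set Φ.Idx) : Set E :=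
  ⋃ i ∈ J, Φ.petal i

/-- `Φ` is a concatenation of `Ψ`, that is `Φ ≤ Ψ`. -/
def IsConcatenationOf {E : Type u} (Φ Ψ : CyclicPartition E) : Prop :=
  ∃ f : Ψ.Idx → Φ.Idx, (∀ i, Ψ.petal i ⊆ Φ.petal (f i)) ∧
    ∀ J : Set Φ.Idx, IsCyclicInterval J → IsCyclicInterval (f ⁻¹' J)

/-- `Φ ≤_A Ψ`: the partition of `Φ` is coarser than (or equal to) the partition of `Ψ`. -/
def LeA {E : Type u} (Φ Ψ : CyclicPartition E) : Prop :=
  ∀ j : Ψ.Idx, ∃ i : Φ.Idx, Ψ.petal j ⊆ Φ.petal i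

/-- All unions of intervals of petals have order at most `k - 1`. -/
def IsPseudoFlower {E : Type u} (lam : Set E → ℕ∞) (k : ℕ) (Φ : CyclicPartition E) : Prop :=
  ∀ J : Set Φ.Idx, IsCyclicInterval J → lam (Φ.unionOf J) < (k : ℕ∞)

/-- A `k`-flower: a `k`-pseudo-flower with at least four petals in which the union of any
non-trivial interval of petals has order exactly `k - 1`. -/
def IsFlower {E : Type u} (lam : Set E → ℕ∞) (k : ℕ) (Φ : CyclicPartition E) : Prop :=
  Φ.IsPseudoFlower lam k ∧ 4 ≤ ENat.card Φ.Idx ∧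
    ∀ J : Set Φ.Idx, IsCyclicInterval J → J.Nonempty → J ≠ Set.univ →
      lam (Φ.unionOf J) + 1 = (k : ℕ∞)

/-- A `k`-anemone: a `k`-flower such that all non-trivial unions of petals of its finite
concatenations have order exactly `k - 1`. -/
def IsAnemone {E : Type u} (lam : Set E → ℕ∞) (k : ℕ) (Φ : CyclicPartition E) : Prop :=
  Φ.IsFlower lam k ∧
    ∀ Ψ : CyclicPartition E, Ψ.IsPseudoFlower lam k → Ψ.IsConcatenationOf Φ → Finite Ψ.Idx →
      ∀ J : Set Ψ.Idx, J.Nonempty → J ≠ Set.univ → lam (Ψ.unionOf J) + 1 = (k : ℕ∞)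

/-- A strong `k`-pseudo-anemone: a `k`-pseudo-flower all of whose unions of petals have order
at most `k - 1`. -/
def IsStrongPseudoAnemone {E : Type u} (lam : Set E → ℕ∞) (k : ℕ) (Φ : CyclicPartition E) :
    Prop :=
  Φ.IsPseudoFlower lam k ∧ ∀ J : Set Φ.Idx, lam (Φ.unionOf J) < (k : ℕ∞)

/-- At least `n` elements of `Prf` are pairwise distinguished by separations displayed by `Φ`,
that is by unions of non-trivial intervals of petals. -/
def DistinguishesAtLeast {E : Type u} (Prf : Set (Set (Set E))) (n : ℕ) (Φ : CyclicPartition E) :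
    Prop :=
  ∃ p : Fin n → Set (Set E), (∀ a, p a ∈ Prf) ∧ ∀ a b, a ≠ b →
    ∃ J : Set Φ.Idx, IsCyclicInterval J ∧ J.Nonempty ∧ J ≠ Set.univ ∧
      Distinguishes (Φ.unionOf J) (p a) (p b)

/-- `Φ ≼ Ψ`: any two profiles in `Prf` distinguished by the union of an interval of `Φ` are also
distinguished by the union of an interval of `Ψ`. -/
def Prec {E : Type u} (Prf : Set (Set (Set E))) (Φ Ψ : CyclicPartition E) : Prop :=
  ∀ P ∈ Prf, ∀ Q ∈ Prf,
    (∃ J : Set Φ.Idx, IsCyclicInterval J ∧ Distinguishes (Φ.unionOf J) P Q) →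
      ∃ J : Set Ψ.Idx, IsCyclicInterval J ∧ Distinguishes (Ψ.unionOf J) P Q

/-- `Φ ≼_A Ψ`: any two profiles in `Prf` distinguished by a union of petals of `Φ` are also
distinguished by a union of petals of `Ψ`. -/
def PrecA {E : Type u} (Prf : Set (Set (Set E))) (Φ Ψ : CyclicPartition E) : Prop :=
  ∀ P ∈ Prf, ∀ Q ∈ Prf,
    (∃ J : Set Φ.Idx, Distinguishes (Φ.unionOf J) P Q) →
      ∃ J : Set Ψ.Idx, Distinguishes (Ψ.unionOf J) P Q

end CyclicPartition

/-- `x` is a maximal element, with respect to the pre-order `r`, of the class of objects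
satisfying `p`. -/
def IsMaximalIn {α : Type*} (p : α → Prop) (r : α → α → Prop) (x : α) : Prop :=
  p x ∧ ∀ y, p y → r x y → r y x

open Classical in
/-- The function on the subsets of `E` that is `0` on the empty set and on `E`, and `k - 1` on all
other sets. -/
noncomputable def trivialConnectivity (E : Type u) (k : ℕ) (A : Set E) : ℕ∞ :=
  if A = ∅ ∨ A = Set.univ then 0 else ((k - 1 : ℕ) : ℕ∞)

/-! Call a set small in a profile that contains it and big in one that contains its complement.
Apart from degenerate cases, the small sets of a profile are closed under subsets and unions, as far
as these lie in `S_k`. Let k = m + 1.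

The first part rests on one uncrossing principle, `le_order_inter`: if X and Y are big in p and X is
small in q, then X ∩ Y has order at least m, since p and q agree on sets of lower order.
Submodularity then bounds the opposite corner by m.

Suppose Ψ is above Φ in `PrecA` and distinguishes p from q while Φ does not. Among the three given
profiles, two, p₁ and p₂, differ on Φ from p and from each other, hence also on Ψ. Combining unions
of petals of Ψ gives a set R that is big in p and small in q, p₁ and p₂; combining unions of petals
of Φ gives X₀ that is big in p and q and small in p₁ and p₂. Repeated uncrossing shows that X ∪ (A ∩
R) has order at most m for all disjoint unions of petals A and X of Φ with A ⊆ X₀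
(`exists_refinement`). If X₀ ∩ R were a union of petals of Φ, it would distinguish p from q. So R
cuts a petal inside X₀, and splitting that petal contradicts `LeA`-maximality
(`exists_notMem_sepSystem_of_maximal`).

In the second part every ultrafilter yields a profile, so there are many profiles to tell apart.
Given Φ, order E linearly so that the unions of its intervals are convex or co-convex, and take an
increasing sequence. Moving its even terms behind the rest of the initial segment it generates
alters initial segments only finitely, up to a suitable choice of new ones. The cyclic partition
into singletons in the new order distinguishes all that Φ does: non-principal profiles ignore finite
changes, and principal ones are seen by singletons. It also separates the odd from the even terms,
hence two ultrafilters that no convex set separates (`exists_prec_not_prec`). -/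

/-! ### Regular profiles -/

/-- The properties of a profile that are used below; they fail only for degenerate profiles that
contain the whole ground set. -/
structure IsRegularProfile {E : Type u} (S P : Set (Set E)) : Prop where
  subset : P ⊆ S
  mem_or_compl_mem : ∀ A ∈ S, A ∈ P ∨ Aᶜ ∈ P
  compl_notMem : ∀ A ∈ P, Aᶜ ∉ P
  mono : ∀ A ∈ S, ∀ B ∈ P, A ⊆ B → A ∈ P
  union_mem : ∀ A ∈ P, ∀ B ∈ P, A ∪ B ∈ S → A ∪ B ∈ P

theorem IsProfile.isRegularProfile {E : Type u} {lam : Set E → ℕ∞} {k : ℕ} {P : Set (Set E)}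
    (hP : IsProfile lam k P) (hsymm : ∀ A, lam Aᶜ = lam A)
    (hS : ∃ X ∈ sepSystem lam k, X.Nonempty ∧ X ≠ Set.univ) :
    IsRegularProfile (sepSystem lam k) P := by
  obtain ⟨⟨hsub, hor⟩, hcons, hprof⟩ := hP
  obtain ⟨X, hXS, ⟨a, ha⟩, hXu⟩ := hS
  have hc : ∀ A ∈ sepSystem lam k, Aᶜ ∈ sepSystem lam k := fun A hA => by
    simpa [sepSystem, hsymm] using hA
  have hmem : ∀ A ∈ sepSystem lam k, A ∈ P ∨ Aᶜ ∈ P := fun A hA => by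
    obtain ⟨B, ⟨hB, rfl | rfl⟩, -⟩ := hor A hA
    · exact Or.inl hB
    · exact Or.inr hB
  have hnot : ∀ A ∈ P, Aᶜ ∉ P := fun A hA hA' => by
    obtain ⟨B, -, hB⟩ := hor A (hsub hA)
    have h : A = Aᶜ := (hB A ⟨hA, Or.inl rfl⟩).trans (hB Aᶜ ⟨hA', Or.inr rfl⟩).symm
    have : a ∈ A ↔ a ∈ Aᶜ := by rw [← h]
    simp at this
  -- If `univ` were in `P`, consistency would exclude both orientations of the proper set `X`.
  have huniv : Set.univ ∉ P := fun hu => by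
    have key : ∀ A : Set E, A ≠ Set.univ → A ≠ ∅ → Aᶜ ∉ P := fun A h1 h2 hA =>
      hcons ⟨A, Set.univ, hA, hu, h1.symm, fun h => h2 (by simpa using h.symm),
        Set.ssubset_univ_iff.2 h1⟩
    have hXe : X ≠ ∅ := Set.Nonempty.ne_empty ⟨a, ha⟩
    rcases hmem X hXS with h | h
    · exact key Xᶜ (by simpa using hXe) (by simpa using hXu) (by simpa using h)
    · exact key X hXu hXe h
  refine ⟨hsub, hmem, hnot, fun A hA B hB hAB => ?_, fun A hA B hB hAB => ?_⟩
  · by_cases h : A = B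
    · exact h ▸ hB
    refine (hmem A hA).resolve_right fun hA' => hcons ⟨A, B, hA', hB, fun h' => h h'.symm, ?_,
      lt_of_le_of_ne hAB h⟩
    -- Consistency says nothing when `B = Aᶜ`; but then `A ⊆ Aᶜ` forces `A = ∅` and `B = univ`.
    rintro rfl
    have : A = ∅ := Set.eq_empty_of_forall_notMem fun x hx => hAB hx hx
    exact huniv (by simpa [this] using hB)
  · exact (hmem _ hAB).resolve_right (hprof A hA B hB)

namespace IsRegularProfile

variable {E : Type u} {S P : Set (Set E)} {A B : Set E}

theorem compl_mem_iff (hP : IsRegularProfile S P) (hA : A ∈ S) : Aᶜ ∈ P ↔ A ∉ P :=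
  ⟨fun h h' => hP.compl_notMem A h' h, fun h => (hP.mem_or_compl_mem A hA).resolve_left h⟩

theorem union_mem_iff (hP : IsRegularProfile S P) (hA : A ∈ S) (hB : B ∈ S) (hAB : A ∪ B ∈ S) :
    A ∪ B ∈ P ↔ A ∈ P ∧ B ∈ P :=
  ⟨fun h => ⟨hP.mono A hA _ h Set.subset_union_left, hP.mono B hB _ h Set.subset_union_right⟩,
    fun h => hP.union_mem A h.1 B h.2 hAB⟩

theorem inter_mem_iff (hP : IsRegularProfile S P) (hS : ∀ A ∈ S, Aᶜ ∈ S) (hA : A ∈ S)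
    (hB : B ∈ S) (hAB : A ∩ B ∈ S) : A ∩ B ∈ P ↔ A ∈ P ∨ B ∈ P := by
  have h := hP.union_mem_iff (hS A hA) (hS B hB) (by rw [← Set.compl_inter]; exact hS _ hAB)
  rw [← Set.compl_inter, hP.compl_mem_iff hAB, hP.compl_mem_iff hA, hP.compl_mem_iff hB] at h
  tauto

end IsRegularProfile

/-- A set of separations in `S` closed under complements and unions. -/
structure IsSetAlgebraIn {E : Type u} (S F : Set (Set E)) : Prop where
  subset : F ⊆ S
  compl_mem : ∀ A ∈ F, Aᶜ ∈ F
  union_mem : ∀ A ∈ F, ∀ B ∈ F, A ∪ B ∈ F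

namespace IsSetAlgebraIn

variable {E : Type u} {S F P Q : Set (Set E)} {A B : Set E}

theorem inter_mem (hF : IsSetAlgebraIn S F) (hA : A ∈ F) (hB : B ∈ F) : A ∩ B ∈ F := by
  have := hF.compl_mem _ (hF.union_mem _ (hF.compl_mem A hA) _ (hF.compl_mem B hB))
  simpa [Set.compl_union] using this

theorem diff_mem (hF : IsSetAlgebraIn S F) (hA : A ∈ F) (hB : B ∈ F) : A \ B ∈ F :=
  hF.inter_mem hA (hF.compl_mem B hB)

theorem compl_iff (hF : IsSetAlgebraIn S F) (hP : IsRegularProfile S P) (hA : A ∈ F) :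
    Aᶜ ∈ P ↔ A ∉ P :=
  hP.compl_mem_iff (hF.subset hA)

theorem union_iff (hF : IsSetAlgebraIn S F) (hP : IsRegularProfile S P) (hA : A ∈ F)
    (hB : B ∈ F) : A ∪ B ∈ P ↔ A ∈ P ∧ B ∈ P :=
  hP.union_mem_iff (hF.subset hA) (hF.subset hB) (hF.subset (hF.union_mem _ hA _ hB))

theorem inter_iff (hF : IsSetAlgebraIn S F) (hP : IsRegularProfile S P) (hA : A ∈ F)
    (hB : B ∈ F) : A ∩ B ∈ P ↔ A ∈ P ∨ B ∈ P := by
  have h := hF.union_iff hP (hF.compl_mem A hA) (hF.compl_mem B hB)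
  rw [← Set.compl_inter, hF.compl_iff hP (hF.inter_mem hA hB), hF.compl_iff hP hA,
    hF.compl_iff hP hB] at h
  tauto

theorem diff_iff (hF : IsSetAlgebraIn S F) (hP : IsRegularProfile S P) (hA : A ∈ F)
    (hB : B ∈ F) : A \ B ∈ P ↔ A ∈ P ∨ B ∉ P := by
  rw [← hF.compl_iff hP hB]
  exact hF.inter_iff hP hA (hF.compl_mem B hB)

/-- Two profiles that disagree on an algebra are separated by it in both directions. -/
theorem exists_separating (hF : IsSetAlgebraIn S F) (hP : IsRegularProfile S P)
    (hQ : IsRegularProfile S Q) (h : ∃ A ∈ F, ¬ (A ∈ P ↔ A ∈ Q)) : ∃ A ∈ F, A ∉ P ∧ A ∈ Q := by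
  obtain ⟨A, hA, h⟩ := h
  by_cases hAP : A ∈ P
  · exact ⟨Aᶜ, hF.compl_mem A hA, by rw [hF.compl_iff hP hA]; tauto,
      by rw [hF.compl_iff hQ hA]; tauto⟩
  · exact ⟨A, hA, hAP, by tauto⟩

/-- If any of `p`, `p'` is separated from any of `q`, `q'`, then the pairs are separated. -/
theorem exists_separating_pairs {p p' q q' : Set (Set E)} (hF : IsSetAlgebraIn S F)
    (hp : IsRegularProfile S p) (hp' : IsRegularProfile S p') (hq : IsRegularProfile S q)
    (hq' : IsRegularProfile S q') (h₁ : ∃ A ∈ F, A ∉ p ∧ A ∈ q) (h₂ : ∃ A ∈ F, A ∉ p ∧ A ∈ q')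
    (h₃ : ∃ A ∈ F, A ∉ p' ∧ A ∈ q) (h₄ : ∃ A ∈ F, A ∉ p' ∧ A ∈ q') :
    ∃ A ∈ F, A ∉ p ∧ A ∉ p' ∧ A ∈ q ∧ A ∈ q' := by
  obtain ⟨A, hA, hA₁, hA₂⟩ := h₁
  obtain ⟨B, hB, hB₁, hB₂⟩ := h₂
  obtain ⟨C, hC, hC₁, hC₂⟩ := h₃
  obtain ⟨D, hD, hD₁, hD₂⟩ := h₄
  have hAB := hF.inter_mem hA hB
  have hCD := hF.inter_mem hC hD
  -- An intersection is small once one factor is, and a union is big once one part is: `A ∩ B` is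
  -- big in `p`, `C ∩ D` is big in `p'`, and both are small in `q` and `q'`.
  refine ⟨A ∩ B ∪ C ∩ D, hF.union_mem _ hAB _ hCD, ?_, ?_, ?_, ?_⟩
  · rw [hF.union_iff hp hAB hCD, hF.inter_iff hp hA hB]; tauto
  · rw [hF.union_iff hp' hAB hCD, hF.inter_iff hp' hC hD]; tauto
  · rw [hF.union_iff hq hAB hCD, hF.inter_iff hq hA hB, hF.inter_iff hq hC hD]; tauto
  · rw [hF.union_iff hq' hAB hCD, hF.inter_iff hq' hA hB, hF.inter_iff hq' hC hD]; tauto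

end IsSetAlgebraIn

/-! ### Uncrossing separations that distinguish profiles -/

/-- A set of regular `(m + 1)`-profiles with the same truncation to the sets of order less than
`m`, for a connectivity function `lam`. -/
structure IsProfileFamily {E : Type u} (lam : Set E → ℕ∞) (m : ℕ) (Prf : Set (Set (Set E))) :
    Prop where
  symm : ∀ A : Set E, lam Aᶜ = lam A
  submodular : ∀ A B : Set E, lam (A ∪ B) + lam (A ∩ B) ≤ lam A + lam B
  regular : ∀ P ∈ Prf, IsRegularProfile (sepSystem lam (m + 1)) P
  agree : ∀ P ∈ Prf, ∀ Q ∈ Prf, ∀ A, lam A < m → A ∈ P → A ∈ Q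

namespace IsProfileFamily

variable {E : Type u} {lam : Set E → ℕ∞} {m : ℕ} {Prf : Set (Set (Set E))}
  {F G : Set (Set E)}

theorem mem_sepSystem {A : Set E} : A ∈ sepSystem lam (m + 1) ↔ lam A ≤ m := by
  simp [sepSystem, ENat.lt_add_one_iff]

theorem compl_mem (h : IsProfileFamily lam m Prf) {A : Set E} (hA : A ∈ sepSystem lam (m + 1)) :
    Aᶜ ∈ sepSystem lam (m + 1) := by
  rw [mem_sepSystem, h.symm]; exact mem_sepSystem.1 hA

/-- Were the order below `m`, then `X ∩ Y`, small in `q` as a subset of `X`, would be small in `p`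
by agreement, although an intersection of two big sets is big. -/
theorem le_order_inter (h : IsProfileFamily lam m Prf) {p q : Set (Set E)} (hp : p ∈ Prf)
    (hq : q ∈ Prf) {X Y : Set E} (hX : X ∈ sepSystem lam (m + 1))
    (hY : Y ∈ sepSystem lam (m + 1)) (hXp : X ∉ p) (hYp : Y ∉ p) (hXq : X ∈ q) :
    (m : ℕ∞) ≤ lam (X ∩ Y) := by
  by_contra! hlt
  have hS : X ∩ Y ∈ sepSystem lam (m + 1) := mem_sepSystem.2 hlt.le
  have h1 := h.agree q hq p hp _ hlt
    ((h.regular q hq).mono _ hS X hXq Set.inter_subset_left)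
  rw [(h.regular p hp).inter_mem_iff (fun _ => h.compl_mem) hX hY hS] at h1
  tauto

theorem inter_mem_of_le_order (h : IsProfileFamily lam m Prf) {A B : Set E}
    (hA : A ∈ sepSystem lam (m + 1)) (hB : B ∈ sepSystem lam (m + 1))
    (hU : (m : ℕ∞) ≤ lam (A ∪ B)) : A ∩ B ∈ sepSystem lam (m + 1) := by
  rw [mem_sepSystem] at *
  have h1 : (m : ℕ∞) + lam (A ∩ B) ≤ m + m :=
    ((add_le_add_left hU _).trans (h.submodular A B)).trans (add_le_add hA hB)
  exact (ENat.add_le_add_iff_left (ENat.natCast_ne_top m)).1 h1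

theorem union_mem_of_le_order (h : IsProfileFamily lam m Prf) {A B : Set E}
    (hA : A ∈ sepSystem lam (m + 1)) (hB : B ∈ sepSystem lam (m + 1))
    (hI : (m : ℕ∞) ≤ lam (A ∩ B)) : A ∪ B ∈ sepSystem lam (m + 1) := by
  have := h.compl_mem (h.inter_mem_of_le_order (h.compl_mem hA) (h.compl_mem hB)
    (by rwa [← Set.compl_inter, h.symm]))
  simpa [Set.compl_inter] using this

/-- Two sets can be uncrossed if the complement of their union is an intersection of sets that
are both big in one profile, one of them being small in another profile. -/
theorem inter_mem_of_compl (h : IsProfileFamily lam m Prf) {A B C D : Set E} {p q : Set (Set E)}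
    (hp : p ∈ Prf) (hq : q ∈ Prf) (hA : A ∈ sepSystem lam (m + 1))
    (hB : B ∈ sepSystem lam (m + 1)) (hC : C ∈ sepSystem lam (m + 1))
    (hD : D ∈ sepSystem lam (m + 1)) (hCp : C ∉ p) (hDp : D ∉ p) (hCq : C ∈ q)
    (hU : (A ∪ B)ᶜ = C ∩ D) : A ∩ B ∈ sepSystem lam (m + 1) := by
  refine h.inter_mem_of_le_order hA hB ?_
  rw [← h.symm, hU]
  exact h.le_order_inter hp hq hC hD hCp hDp hCq

theorem union_mem_of_inter (h : IsProfileFamily lam m Prf) {A B : Set E} {p q : Set (Set E)}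
    (hp : p ∈ Prf) (hq : q ∈ Prf) (hA : A ∈ sepSystem lam (m + 1))
    (hB : B ∈ sepSystem lam (m + 1)) (hAp : A ∉ p) (hBp : B ∉ p) (hAq : A ∈ q) :
    A ∪ B ∈ sepSystem lam (m + 1) :=
  h.union_mem_of_le_order hA hB (h.le_order_inter hp hq hA hB hAp hBp hAq)

section Crossing

variable {p q p₁ p₂ : Set (Set E)} {X₀ T₁ T₂ : Set E}

/-- The set is built up by four uncrossings, through `X ∪ T₂`, `X ∪ X₀ ∩ T₂` and `X₀ᶜ ∪ T₁`. Each
time the opposite corner is an intersection of two sets that are big in a common profile: `p₂`,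
`p₁`, `p₁` and `q`, in this order. -/
theorem union_inter_mem_of_separates (h : IsProfileFamily lam m Prf)
    (hF : IsSetAlgebraIn (sepSystem lam (m + 1)) F) (hG : IsSetAlgebraIn (sepSystem lam (m + 1)) G)
    (hp : p ∈ Prf) (hq : q ∈ Prf) (hp₁ : p₁ ∈ Prf) (hp₂ : p₂ ∈ Prf)
    (hX₀ : X₀ ∈ F) (hX₀p : X₀ ∉ p) (hX₀q : X₀ ∉ q) (hX₀p₁ : X₀ ∈ p₁)
    (hT₁ : T₁ ∈ G) (hT₁q : T₁ ∈ q) (hT₁p₁ : T₁ ∉ p₁)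
    (hT₂ : T₂ ∈ G) (hT₂q : T₂ ∈ q) (hT₂p₁ : T₂ ∈ p₁) (hT₂p₂ : T₂ ∉ p₂)
    {X : Set E} (hX : X ∈ F) (hdisj : X ⊆ X₀ᶜ) (hXp₁ : X ∈ p₁) (hXp₂ : X ∉ p₂) :
    X ∪ X₀ ∩ (T₁ ∩ T₂) ∈ sepSystem lam (m + 1) := by
  have rp := h.regular p hp
  have rq := h.regular q hq
  have r₁ := h.regular p₁ hp₁
  have hXX₀ := hF.union_mem _ hX _ hX₀
  have e1 : X ∪ T₂ ∈ sepSystem lam (m + 1) :=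
    h.union_mem_of_inter hp₂ hp₁ (hF.subset hX) (hG.subset hT₂) hXp₂ hT₂p₂ hXp₁
  have e2 : X ∪ X₀ ∩ T₂ ∈ sepSystem lam (m + 1) := by
    have : (X ∪ X₀) ∩ (X ∪ T₂) ∈ sepSystem lam (m + 1) := by
      refine h.inter_mem_of_compl hp₁ hp (hF.subset hXX₀) e1
        (hF.subset (hF.compl_mem _ hXX₀)) (hG.subset (hG.compl_mem _ hT₂)) ?_ ?_ ?_ ?_
      · rw [hF.compl_iff r₁ hXX₀, hF.union_iff r₁ hX hX₀]; tauto
      · rw [hG.compl_iff r₁ hT₂]; tauto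
      · rw [hF.compl_iff rp hXX₀, hF.union_iff rp hX hX₀]; tauto
      · ext x; simp only [Set.mem_compl_iff, Set.mem_union, Set.mem_inter_iff]; tauto
    rwa [← Set.union_inter_distrib_left] at this
  have e3 : X₀ᶜ ∪ T₁ ∈ sepSystem lam (m + 1) := by
    refine h.union_mem_of_inter hp₁ hp (hF.subset (hF.compl_mem _ hX₀)) (hG.subset hT₁) ?_ hT₁p₁ ?_
    · rw [hF.compl_iff r₁ hX₀]; tauto
    · rwa [hF.compl_iff rp hX₀]
  have hTT := hG.union_mem _ hT₁ _ hT₂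
  have e4 : (X ∪ X₀ ∩ T₂) ∩ (X₀ᶜ ∪ T₁) ∈ sepSystem lam (m + 1) := by
    refine h.inter_mem_of_compl hq hp₁ e2 e3 (hF.subset hX₀) (hG.subset (hG.compl_mem _ hTT))
      hX₀q ?_ hX₀p₁ ?_
    · rw [hG.compl_iff rq hTT, hG.union_iff rq hT₁ hT₂]; tauto
    · ext x
      have := @hdisj x
      simp only [Set.mem_compl_iff, Set.mem_union, Set.mem_inter_iff] at *; tauto
  convert e4 using 1
  ext x
  have := @hdisj x
  simp only [Set.mem_compl_iff, Set.mem_union, Set.mem_inter_iff] at *; tauto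

/-- Any union of sets of the algebra with the part of `X₀` in `T₁ ∩ T₂` is a separation. -/
theorem union_inter_mem (h : IsProfileFamily lam m Prf)
    (hF : IsSetAlgebraIn (sepSystem lam (m + 1)) F) (hG : IsSetAlgebraIn (sepSystem lam (m + 1)) G)
    (hp : p ∈ Prf) (hq : q ∈ Prf) (hp₁ : p₁ ∈ Prf) (hp₂ : p₂ ∈ Prf)
    (hsep : ∃ A ∈ F, A ∉ p₁ ∧ A ∈ p₂)
    (hT₁ : T₁ ∈ G) (hT₁p : T₁ ∉ p) (hT₁q : T₁ ∈ q) (hT₁p₁ : T₁ ∉ p₁) (hT₁p₂ : T₁ ∈ p₂)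
    (hT₂ : T₂ ∈ G) (hT₂p : T₂ ∉ p) (hT₂q : T₂ ∈ q) (hT₂p₁ : T₂ ∈ p₁) (hT₂p₂ : T₂ ∉ p₂)
    (hX₀ : X₀ ∈ F) (hX₀p : X₀ ∉ p) (hX₀q : X₀ ∉ q) (hX₀p₁ : X₀ ∈ p₁) (hX₀p₂ : X₀ ∈ p₂)
    {X : Set E} (hX : X ∈ F) (hdisj : X ⊆ X₀ᶜ) :
    X ∪ X₀ ∩ (T₁ ∩ T₂) ∈ sepSystem lam (m + 1) := by
  have rp := h.regular p hp
  have rq := h.regular q hq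
  have r₁ := h.regular p₁ hp₁
  have r₂ := h.regular p₂ hp₂
  have hone : ∀ X ∈ F, X ⊆ X₀ᶜ → X ∈ p₁ → X ∉ p₂ →
      X ∪ X₀ ∩ (T₁ ∩ T₂) ∈ sepSystem lam (m + 1) := fun X hX hd h1 h2 =>
    h.union_inter_mem_of_separates hF hG hp hq hp₁ hp₂ hX₀ hX₀p hX₀q hX₀p₁ hT₁ hT₁q hT₁p₁ hT₂ hT₂q
      hT₂p₁ hT₂p₂ hX hd h1 h2
  have htwo : ∀ X ∈ F, X ⊆ X₀ᶜ → X ∉ p₁ → X ∈ p₂ →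
      X ∪ X₀ ∩ (T₁ ∩ T₂) ∈ sepSystem lam (m + 1) := fun X hX hd h1 h2 => by
    rw [Set.inter_comm T₁]
    exact h.union_inter_mem_of_separates hF hG hp hq hp₂ hp₁ hX₀ hX₀p hX₀q hX₀p₂ hT₂ hT₂q hT₂p₂
      hT₁ hT₁q hT₁p₂ hT₁p₁ hX hd h2 h1
  have hTT := hG.inter_mem hT₁ hT₂
  obtain ⟨X₁, hX₁, hX₁p₁, hX₁p₂⟩ := hsep
  by_cases h1 : X ∈ p₁ <;> by_cases h2 : X ∈ p₂
  -- `X` is small in both: enlarge it by the two parts into which `X₁` cuts the complement of `X ∪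
  -- X₀`. Each enlargement is big in exactly one of `p₁`, `p₂`, and intersecting the results
  -- recovers `X`.
  · set Y := X₁ \ (X ∪ X₀) with hY
    set Z := (X ∪ X₀ ∪ X₁)ᶜ with hZ
    have hXX₀ := hF.union_mem _ hX _ hX₀
    have hYF : Y ∈ F := hF.diff_mem hX₁ hXX₀
    have hXXX := hF.union_mem _ hXX₀ _ hX₁
    have hZF : Z ∈ F := hF.compl_mem _ hXXX
    have a1 := htwo (X ∪ Y) (hF.union_mem _ hX _ hYF)
      (by intro x hx; have := @hdisj x; simp [Y] at *; tauto)
      (by rw [hF.union_iff r₁ hX hYF, hF.diff_iff r₁ hX₁ hXX₀, hF.union_iff r₁ hX hX₀]; tauto)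
      (by rw [hF.union_iff r₂ hX hYF, hF.diff_iff r₂ hX₁ hXX₀]; tauto)
    have a2 := hone (X ∪ Z) (hF.union_mem _ hX _ hZF)
      (by intro x hx; have := @hdisj x; simp [Z] at *; tauto)
      (by rw [hF.union_iff r₁ hX hZF, hF.compl_iff r₁ hXXX, hF.union_iff r₁ hXX₀ hX₁]; tauto)
      (by rw [hF.union_iff r₂ hX hZF, hF.compl_iff r₂ hXXX, hF.union_iff r₂ hXX₀ hX₁,
            hF.union_iff r₂ hX hX₀]; tauto)
    have := h.inter_mem_of_compl hq hp₁ a1 a2 (hF.subset hX₀) (hG.subset (hG.compl_mem _ hTT))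
      hX₀q (by rw [hG.compl_iff rq hTT, hG.inter_iff rq hT₁ hT₂]; tauto) hX₀p₁
      (by
        ext x
        have := @hdisj x
        simp only [Y, Z, Set.mem_compl_iff, Set.mem_union, Set.mem_inter_iff,
          Set.mem_sdiff] at this ⊢
        clear * - this
        tauto)
    convert this using 1
    ext x
    simp only [Y, Z, Set.mem_compl_iff, Set.mem_union, Set.mem_inter_iff, Set.mem_sdiff]
    clear * -
    tauto
  · exact hone X hX hdisj h1 h2
  · exact htwo X hX hdisj h1 h2
  -- `X` is big in both: `X₁` cuts it into two parts, each big in exactly one of `p₁`, `p₂`.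
  · have b1 := htwo (X ∩ X₁) (hF.inter_mem hX hX₁) (Set.inter_subset_left.trans hdisj)
      (by rw [hF.inter_iff r₁ hX hX₁]; tauto) (by rw [hF.inter_iff r₂ hX hX₁]; tauto)
    have b2 := hone (X \ X₁) (hF.diff_mem hX hX₁) (Set.sdiff_subset.trans hdisj)
      (by rw [hF.diff_iff r₁ hX hX₁]; tauto) (by rw [hF.diff_iff r₂ hX hX₁]; tauto)
    have e : X ∪ X₀ ∩ (T₁ ∩ T₂) = (X ∩ X₁ ∪ X₀ ∩ (T₁ ∩ T₂)) ∪ (X \ X₁ ∪ X₀ ∩ (T₁ ∩ T₂)) := by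
      ext x
      simp only [Set.mem_union, Set.mem_inter_iff, Set.mem_sdiff]
      tauto
    rw [e]
    refine h.union_mem_of_le_order b1 b2 ?_
    have e' : (X ∩ X₁ ∪ X₀ ∩ (T₁ ∩ T₂)) ∩ (X \ X₁ ∪ X₀ ∩ (T₁ ∩ T₂)) = X₀ ∩ (T₁ ∩ T₂) := by
      ext x
      simp only [Set.mem_union, Set.mem_inter_iff, Set.mem_sdiff]
      tauto
    rw [e']
    exact h.le_order_inter hp hp₁ (hF.subset hX₀) (hG.subset hTT) hX₀p
      (by rw [hG.inter_iff rp hT₁ hT₂]; tauto) hX₀p₁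

end Crossing

/-- If the parts in `R` of sets of the algebra that are big in `p` and `q` can be added freely,
then so can the part in `R` of any subset of such a set. -/
theorem union_inter_mem_of_small (h : IsProfileFamily lam m Prf)
    (hF : IsSetAlgebraIn (sepSystem lam (m + 1)) F) {p q : Set (Set E)}
    (hp : p ∈ Prf) (hq : q ∈ Prf) (hpq : ∀ A ∈ F, A ∈ p ↔ A ∈ q) {R X₀ A X : Set E}
    (hR : R ∈ sepSystem lam (m + 1)) (hRp : R ∉ p) (hRq : R ∈ q)
    (hclaim : ∀ Y ∈ F, Y ⊆ X₀ → Y ∉ p → ∀ X ∈ F, X ⊆ Yᶜ →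
      X ∪ Y ∩ R ∈ sepSystem lam (m + 1))
    (hX₀ : X₀ ∈ F) (hX₀p : X₀ ∉ p) (hA : A ∈ F) (hAX₀ : A ⊆ X₀) (hAp : A ∈ p)
    (hX : X ∈ F) (hXA : X ⊆ Aᶜ) (hXp : X ∈ p) : X ∪ A ∩ R ∈ sepSystem lam (m + 1) := by
  have rp := h.regular p hp
  have rq := h.regular q hq
  have hXA' := hF.union_mem _ hX _ hA
  have hY := hF.diff_mem hX₀ hX
  have hYp : X₀ \ X ∉ p := by rw [hF.diff_iff rp hX₀ hX]; tauto
  have hY' := hF.diff_mem hX₀ hXA'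
  have hY'p : X₀ \ (X ∪ A) ∉ p := by
    rw [hF.diff_iff rp hX₀ hXA', hF.union_iff rp hX hA]; tauto
  have hY'q : X₀ \ (X ∪ A) ∉ q := by rwa [← hpq _ hY']
  have c1 := hclaim _ hY Set.sdiff_subset hYp X hX
    (by intro x hx; simp only [Set.mem_compl_iff, Set.mem_sdiff]; tauto)
  have c2 := hclaim _ hY' Set.sdiff_subset hY'p (X ∪ A) hXA'
    (by intro x hx; simp only [Set.mem_compl_iff, Set.mem_sdiff]; tauto)
  have c3 := hclaim _ hY' Set.sdiff_subset hY'p _ (hF.compl_mem _ hY') subset_rfl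
  have e : X ∪ A ∩ R = (X ∪ (X₀ \ X) ∩ R) ∩ (X ∪ A) := by
    ext x
    have := @hXA x
    have := @hAX₀ x
    simp only [Set.mem_compl_iff, Set.mem_union, Set.mem_inter_iff, Set.mem_sdiff] at *
    tauto
  have eU : (X ∪ (X₀ \ X) ∩ R) ∪ (X ∪ A) = X ∪ A ∪ (X₀ \ (X ∪ A)) ∩ R := by
    ext x
    simp only [Set.mem_union, Set.mem_inter_iff, Set.mem_sdiff]
    tauto
  rw [e]
  refine h.inter_mem_of_le_order c1 (hF.subset hXA') ?_
  rw [eU]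
  -- An order below `m` would make `p` and `q` agree on this union. It is big in `p` because of its
  -- part in `R`, and big in `q` would fail only if its complement were big there; but that
  -- complement contains `(X₀ \ (X ∪ A)) ∩ Rᶜ`, which is big in `q`.
  by_contra! hlt
  have hW : (X₀ \ (X ∪ A)) ∩ R ∈ sepSystem lam (m + 1) := by
    simpa using hclaim _ hY' Set.sdiff_subset hY'p ∅ (by simpa using hF.diff_mem hA hA) (by simp)
  have hV : (X₀ \ (X ∪ A)) ∩ Rᶜ ∈ sepSystem lam (m + 1) := by
    convert h.compl_mem c3 using 1
    ext x
    simp only [Set.mem_compl_iff, Set.mem_union, Set.mem_inter_iff, Set.mem_sdiff]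
    tauto
  have hZp : X ∪ A ∪ (X₀ \ (X ∪ A)) ∩ R ∉ p := fun hZ => by
    have := rp.mono _ hW _ hZ Set.subset_union_right
    rw [rp.inter_mem_iff (fun _ => h.compl_mem) (hF.subset hY') hR hW] at this
    tauto
  have hZq := h.agree p hp q hq _ (by rwa [h.symm]) ((rp.compl_mem_iff c2).2 hZp)
  have := rq.mono _ hV _ hZq (by
    intro x
    simp only [Set.mem_compl_iff, Set.mem_union, Set.mem_inter_iff, Set.mem_sdiff]
    tauto)
  rw [rq.inter_mem_iff (fun _ => h.compl_mem) (hF.subset hY') (h.compl_mem hR) hV,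
    rq.compl_mem_iff hR] at this
  tauto

/-- Under the same assumption, the part in `R` of any subset of such a set can be added freely. -/
theorem union_inter_mem_of_forall (h : IsProfileFamily lam m Prf)
    (hF : IsSetAlgebraIn (sepSystem lam (m + 1)) F) {p q : Set (Set E)}
    (hp : p ∈ Prf) (hq : q ∈ Prf) (hpq : ∀ A ∈ F, A ∈ p ↔ A ∈ q) {R X₀ A X : Set E}
    (hR : R ∈ sepSystem lam (m + 1)) (hRp : R ∉ p) (hRq : R ∈ q)
    (hclaim : ∀ Y ∈ F, Y ⊆ X₀ → Y ∉ p → ∀ X ∈ F, X ⊆ Yᶜ →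
      X ∪ Y ∩ R ∈ sepSystem lam (m + 1))
    (hX₀ : X₀ ∈ F) (hX₀p : X₀ ∉ p) (hA : A ∈ F) (hAX₀ : A ⊆ X₀)
    (hX : X ∈ F) (hXA : X ⊆ Aᶜ) : X ∪ A ∩ R ∈ sepSystem lam (m + 1) := by
  have rp := h.regular p hp
  have rq := h.regular q hq
  have hcompl : ∀ Y X R : Set E, X ⊆ Yᶜ → X ∪ Y ∩ Rᶜ = ((X ∪ Y)ᶜ ∪ Y ∩ R)ᶜ := by
    intro Y X R hd
    ext x
    have := @hd x
    simp only [Set.mem_compl_iff, Set.mem_union, Set.mem_inter_iff] at *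
    tauto
  have hsub : ∀ Y X : Set E, (X ∪ Y)ᶜ ⊆ Yᶜ := fun Y X =>
    Set.compl_subset_compl.2 Set.subset_union_right
  by_cases hAp : A ∈ p
  · by_cases hXp : X ∈ p
    · exact h.union_inter_mem_of_small hF hp hq hpq hR hRp hRq hclaim hX₀ hX₀p hA hAX₀ hAp hX hXA
        hXp
    · have hXA' := hF.union_mem _ hX _ hA
      -- Passing to complements replaces `X` by `(X ∪ A)ᶜ`, which is small, and exchanges `R` with
      -- `Rᶜ` and thus the roles of `p` and `q`.
      have := h.union_inter_mem_of_small (X₀ := X₀) (A := A) hF hq hp (fun B hB => (hpq B hB).symm)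
        (h.compl_mem hR) (by rw [rq.compl_mem_iff hR]; tauto) (by rwa [rp.compl_mem_iff hR])
        (fun Y hY hYX hYq X hX hd => by
          rw [hcompl Y X R hd]
          exact h.compl_mem (hclaim Y hY hYX (by rwa [hpq Y hY]) _
            (hF.compl_mem _ (hF.union_mem _ hX _ hY)) (hsub Y X)))
        hX₀ (by rwa [← hpq _ hX₀]) hA hAX₀ (by rwa [← hpq _ hA]) (hF.compl_mem _ hXA')
        (hsub A X) (by
          rw [hF.compl_iff rq hXA', hF.union_iff rq hX hA, ← hpq X hX]; tauto)
      have h2 := h.compl_mem this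
      have e := hcompl A X Rᶜ hXA
      rw [compl_compl] at e
      rwa [e]
  · exact hclaim A hA hAX₀ hAp X hX hXA

/-- If two profiles that are not distinguished by `F` are distinguished by `G`, and `F` also
distinguishes two further profiles from them and from each other, then `F` can be refined. -/
theorem exists_refinement (h : IsProfileFamily lam m Prf)
    (hF : IsSetAlgebraIn (sepSystem lam (m + 1)) F)
    (hG : IsSetAlgebraIn (sepSystem lam (m + 1)) G) {p q p₁ p₂ : Set (Set E)}
    (hp : p ∈ Prf) (hq : q ∈ Prf) (hp₁ : p₁ ∈ Prf) (hp₂ : p₂ ∈ Prf)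
    (hFG : ∀ P ∈ Prf, ∀ Q ∈ Prf, (∃ A ∈ F, ¬ (A ∈ P ↔ A ∈ Q)) → ∃ A ∈ G, ¬ (A ∈ P ↔ A ∈ Q))
    (hpq : ∀ A ∈ F, A ∈ p ↔ A ∈ q) (hpqG : ∃ A ∈ G, ¬ (A ∈ p ↔ A ∈ q))
    (h₁ : ∃ A ∈ F, ¬ (A ∈ p ↔ A ∈ p₁)) (h₂ : ∃ A ∈ F, ¬ (A ∈ p ↔ A ∈ p₂))
    (h₁₂ : ∃ A ∈ F, ¬ (A ∈ p₁ ↔ A ∈ p₂)) :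
    ∃ X₀ ∈ F, ∃ R, X₀ ∩ R ∉ F ∧
      ∀ A ∈ F, A ⊆ X₀ → ∀ X ∈ F, X ⊆ Aᶜ → X ∪ A ∩ R ∈ sepSystem lam (m + 1) := by
  have rp := h.regular p hp
  have rq := h.regular q hq
  have r₁ := h.regular p₁ hp₁
  have r₂ := h.regular p₂ hp₂
  have swap : ∀ {F : Set (Set E)} {P Q : Set (Set E)}, (∃ A ∈ F, ¬ (A ∈ P ↔ A ∈ Q)) →
      ∃ A ∈ F, ¬ (A ∈ Q ↔ A ∈ P) := fun ⟨A, hA, hA'⟩ => ⟨A, hA, fun e => hA' e.symm⟩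
  have toq : ∀ {Q : Set (Set E)}, (∃ A ∈ F, ¬ (A ∈ p ↔ A ∈ Q)) →
      ∃ A ∈ F, ¬ (A ∈ q ↔ A ∈ Q) := fun ⟨A, hA, hA'⟩ => ⟨A, hA, by rwa [← hpq A hA]⟩
  -- `T₁` is big in just `p` and `p₁`, and `T₂` in just `p` and `p₂`, so among the four profiles `T₁
  -- ∩ T₂` is big in `p` alone.
  obtain ⟨T₁, hT₁, hT₁p, hT₁p₁, hT₁q, hT₁p₂⟩ := hG.exists_separating_pairs rp r₁ rq r₂
    (hG.exists_separating rp rq hpqG) (hG.exists_separating rp r₂ (hFG _ hp _ hp₂ h₂))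
    (hG.exists_separating r₁ rq (swap (hFG _ hq _ hp₁ (toq h₁))))
    (hG.exists_separating r₁ r₂ (hFG _ hp₁ _ hp₂ h₁₂))
  obtain ⟨T₂, hT₂, hT₂p, hT₂p₂, hT₂q, hT₂p₁⟩ := hG.exists_separating_pairs rp r₂ rq r₁
    (hG.exists_separating rp rq hpqG) (hG.exists_separating rp r₁ (hFG _ hp _ hp₁ h₁))
    (hG.exists_separating r₂ rq (swap (hFG _ hq _ hp₂ (toq h₂))))
    (hG.exists_separating r₂ r₁ (swap (hFG _ hp₁ _ hp₂ h₁₂)))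
  obtain ⟨X₀, hX₀, hX₀p, -, hX₀p₁, hX₀p₂⟩ := hF.exists_separating_pairs rp rp r₁ r₂
    (hF.exists_separating rp r₁ h₁) (hF.exists_separating rp r₂ h₂)
    (hF.exists_separating rp r₁ h₁) (hF.exists_separating rp r₂ h₂)
  have hTT := hG.inter_mem hT₁ hT₂
  have hRp : T₁ ∩ T₂ ∉ p := by rw [hG.inter_iff rp hT₁ hT₂]; tauto
  have hRq : T₁ ∩ T₂ ∈ q := by rw [hG.inter_iff rq hT₁ hT₂]; tauto
  refine ⟨X₀, hX₀, T₁ ∩ T₂, fun hmem => ?_, fun A hA hAX₀ X hX hXA => ?_⟩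
  · have h1 := hpq _ hmem
    rw [rp.inter_mem_iff (fun _ => h.compl_mem) (hF.subset hX₀) (hG.subset hTT) (hF.subset hmem),
      rq.inter_mem_iff (fun _ => h.compl_mem) (hF.subset hX₀) (hG.subset hTT) (hF.subset hmem)] at h1
    tauto
  · refine h.union_inter_mem_of_forall hF hp hq hpq (hG.subset hTT) hRp hRq
      (fun Y hY hYX₀ hYp X hX hd => ?_) hX₀ hX₀p hA hAX₀ hX hXA
    exact h.union_inter_mem hF hG hp hq hp₁ hp₂ (hF.exists_separating r₁ r₂ h₁₂) hT₁ hT₁p hT₁q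
      hT₁p₁ hT₁p₂ hT₂ hT₂p hT₂q hT₂p₁ hT₂p₂ hY hYp (by rwa [← hpq Y hY])
      (r₁.mono Y (hF.subset hY) _ hX₀p₁ hYX₀) (r₂.mono Y (hF.subset hY) _ hX₀p₂ hYX₀) hX hd

end IsProfileFamily

/-! ### Unions of petals -/

namespace CyclicPartition

variable {E : Type u}

theorem exists_mem_petal (Φ : CyclicPartition E) (x : E) : ∃ i, x ∈ Φ.petal i := by
  have : x ∈ ⋃ i, Φ.petal i := by rw [Φ.petal_cover]; trivial
  simpa using this

/-- The index of the petal that contains `x`. -/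
noncomputable def index (Φ : CyclicPartition E) (x : E) : Φ.Idx :=
  (Φ.exists_mem_petal x).choose

theorem mem_petal_iff (Φ : CyclicPartition E) {x : E} {i : Φ.Idx} :
    x ∈ Φ.petal i ↔ Φ.index x = i := by
  have h : x ∈ Φ.petal (Φ.index x) := (Φ.exists_mem_petal x).choose_spec
  refine ⟨fun hi => ?_, fun hi => hi ▸ h⟩
  by_contra hne
  exact Set.disjoint_left.1 (Φ.petal_disjoint _ _ hne) h hi

theorem mem_unionOf (Φ : CyclicPartition E) {x : E} {J : Set Φ.Idx} :
    x ∈ Φ.unionOf J ↔ Φ.index x ∈ J := by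
  simp [unionOf, mem_petal_iff]

theorem unionOf_compl (Φ : CyclicPartition E) (J : Set Φ.Idx) :
    Φ.unionOf Jᶜ = (Φ.unionOf J)ᶜ := by
  ext x; simp [mem_unionOf]

theorem unionOf_union (Φ : CyclicPartition E) (J K : Set Φ.Idx) :
    Φ.unionOf (J ∪ K) = Φ.unionOf J ∪ Φ.unionOf K := by
  ext x; simp [mem_unionOf]

theorem unionOf_nonempty (Φ : CyclicPartition E) {J : Set Φ.Idx} (hJ : J.Nonempty) :
    (Φ.unionOf J).Nonempty := by
  obtain ⟨i, hi⟩ := hJ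
  obtain ⟨x, hx⟩ := Φ.petal_nonempty i
  exact ⟨x, Φ.mem_unionOf.2 (by rwa [Φ.mem_petal_iff.1 hx])⟩

theorem unionOf_ne_univ (Φ : CyclicPartition E) {J : Set Φ.Idx} (hJ : J ≠ Set.univ) :
    Φ.unionOf J ≠ Set.univ := by
  obtain ⟨x, hx⟩ := Φ.unionOf_nonempty (Set.nonempty_compl.2 hJ)
  rw [unionOf_compl] at hx
  exact fun h => hx (h ▸ Set.mem_univ x)

/-- The partition into the fibres of a surjection onto a linearly ordered set. -/
def ofSurjective {T : Type u} [o : LinearOrder T] (g : E → T) (hg : Function.Surjective g) :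
    CyclicPartition E where
  Idx := T
  circ := LinearOrder.toCircularOrder T
  petal i := g ⁻¹' {i}
  petal_nonempty i := (hg i).imp fun _ hx => hx
  petal_disjoint i j hij := by
    rw [Set.disjoint_left]
    intro x hx hx'
    exact hij (hx.symm.trans hx')
  petal_cover := by ext x; simp

theorem unionOf_ofSurjective {T : Type u} [LinearOrder T] (g : E → T)
    (hg : Function.Surjective g) (J : Set T) : (ofSurjective g hg).unionOf J = g ⁻¹' J := by
  ext x
  simp only [unionOf, ofSurjective, Set.mem_iUnion, Set.mem_preimage, Set.mem_singleton_iff,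
    exists_prop, exists_eq_right']
  exact Iff.rfl

theorem isSetAlgebraIn_range_unionOf {lam : Set E → ℕ∞} {k : ℕ} {Φ : CyclicPartition E}
    (h : Φ.IsStrongPseudoAnemone lam k) :
    IsSetAlgebraIn (sepSystem lam k) (Set.range Φ.unionOf) where
  subset := by rintro _ ⟨J, rfl⟩; exact h.2 J
  compl_mem := by rintro _ ⟨J, rfl⟩; exact ⟨Jᶜ, Φ.unionOf_compl J⟩
  union_mem := by rintro _ ⟨J, rfl⟩ _ ⟨K, rfl⟩; exact ⟨J ∪ K, Φ.unionOf_union J K⟩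

/-- A `≤_A`-maximal strong pseudo-anemone cannot be refined by splitting petals. -/
theorem exists_notMem_sepSystem_of_maximal {lam : Set E → ℕ∞} {k : ℕ} {Φ : CyclicPartition E}
    (hsymm : ∀ A, lam Aᶜ = lam A)
    (hΦ : IsMaximalIn (CyclicPartition.IsStrongPseudoAnemone lam k) CyclicPartition.LeA Φ)
    {X₀ R : Set E} (hX₀ : X₀ ∈ Set.range Φ.unionOf) (hR : X₀ ∩ R ∉ Set.range Φ.unionOf) :
    ∃ A ∈ Set.range Φ.unionOf, A ⊆ X₀ ∧ ∃ X ∈ Set.range Φ.unionOf, X ⊆ Aᶜ ∧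
      X ∪ A ∩ R ∉ sepSystem lam k := by
  classical
  by_contra! hall
  obtain ⟨J₀, rfl⟩ := hX₀
  have hF := isSetAlgebraIn_range_unionOf hΦ.1
  -- If `R` cut no petal inside `X₀`, then `X₀ ∩ R` would be a union of petals.
  obtain ⟨a, ha, ⟨y, hya, hyR⟩, ⟨z, hza, hzR⟩⟩ :
      ∃ a ∈ J₀, (∃ y ∈ Φ.petal a, y ∈ R) ∧ ∃ z ∈ Φ.petal a, z ∉ R := by
    by_contra! hno
    refine hR ⟨{a | a ∈ J₀ ∧ ∀ x ∈ Φ.petal a, x ∈ R}, ?_⟩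
    ext x
    rw [mem_unionOf]
    refine ⟨fun hx => ⟨Φ.mem_unionOf.2 hx.1, hx.2 x (Φ.mem_petal_iff.2 rfl)⟩, fun hx => ?_⟩
    have hx1 := Φ.mem_unionOf.1 hx.1
    exact ⟨hx1, hno _ hx1 ⟨x, Φ.mem_petal_iff.2 rfl, hx.2⟩⟩
  set A := Φ.unionOf {a} with hAdef
  have hA : A ∈ Set.range Φ.unionOf := ⟨_, rfl⟩
  have hmemA : ∀ x, x ∈ A ↔ Φ.index x = a := fun x => by rw [hAdef, mem_unionOf]; rfl
  have hAX₀ : A ⊆ Φ.unionOf J₀ := fun x hx => by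
    rw [mem_unionOf, (hmemA x).1 hx]; exact ha
  have hin : ∀ X ∈ Set.range Φ.unionOf, X ⊆ Aᶜ → X ∪ A ∩ R ∈ sepSystem lam k :=
    hall A hA hAX₀
  have hout : ∀ X ∈ Set.range Φ.unionOf, X ⊆ Aᶜ → X ∪ A \ R ∈ sepSystem lam k := by
    intro X hX hXA
    have h1 := hin _ (hF.compl_mem _ (hF.union_mem _ hX _ hA))
      (Set.compl_subset_compl.2 Set.subset_union_right)
    have e : X ∪ A \ R = ((X ∪ A)ᶜ ∪ A ∩ R)ᶜ := by
      ext x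
      have := @hXA x
      simp only [Set.mem_compl_iff, Set.mem_union, Set.mem_inter_iff, Set.mem_sdiff] at *
      clear * - this
      tauto
    rw [e]
    rw [sepSystem, Set.mem_ofPred_eq, hsymm]
    exact h1
  -- The fibres of `g` are the petals other than `a` and the two halves of petal `a`. Their order is
  -- immaterial, as all unions of petals will be bounded.
  let g : E → Φ.Idx × Prop := fun x => (Φ.index x, Φ.index x = a ∧ x ∈ R)
  let _ : LinearOrder (Set.range g) := linearOrderOfSTO WellOrderingRel
  let Ψ : CyclicPartition E := ofSurjective (Set.rangeFactorization g)
    Set.rangeFactorization_surjective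
  have hunion : ∀ J : Set (Set.range g),
      (Set.rangeFactorization g) ⁻¹' J ∈ sepSystem lam k := by
    intro J
    set X := Φ.unionOf {i | i ≠ a ∧ ∃ x, Φ.index x = i ∧ Set.rangeFactorization g x ∈ J} with hX
    have hXF : X ∈ Set.range Φ.unionOf := ⟨_, rfl⟩
    have hXA : X ⊆ Aᶜ := fun x hx hxA => (Φ.mem_unionOf.1 hx).1 ((hmemA x).1 hxA)
    have hg : ∀ x x', Φ.index x = Φ.index x' → (Φ.index x = a → (x ∈ R ↔ x' ∈ R)) →
        (Set.rangeFactorization g x ∈ J ↔ Set.rangeFactorization g x' ∈ J) := by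
      intro x x' h1 h2
      have : Set.rangeFactorization g x = Set.rangeFactorization g x' := by
        apply Subtype.ext
        refine Prod.ext h1 (propext ?_)
        change (Φ.index x = a ∧ x ∈ R) ↔ (Φ.index x' = a ∧ x' ∈ R)
        rw [← h1]
        exact and_congr_right h2
      rw [this]
    have hxX : ∀ x, Φ.index x ≠ a → (Set.rangeFactorization g x ∈ J ↔ x ∈ X) := by
      intro x hx
      rw [hX, mem_unionOf]
      refine ⟨fun h => ⟨hx, x, rfl, h⟩, ?_⟩
      rintro ⟨-, x', h1, h2⟩
      exact (hg x x' h1.symm fun h => absurd h hx).2 h2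
    have hy := Φ.mem_petal_iff.1 hya
    have hz := Φ.mem_petal_iff.1 hza
    have hxy : ∀ x, Φ.index x = a → x ∈ R →
        (Set.rangeFactorization g x ∈ J ↔ Set.rangeFactorization g y ∈ J) := fun x hx hxR =>
      hg x y (hx.trans hy.symm) fun _ => iff_of_true hxR hyR
    have hxz : ∀ x, Φ.index x = a → x ∉ R →
        (Set.rangeFactorization g x ∈ J ↔ Set.rangeFactorization g z ∈ J) := fun x hx hxR =>
      hg x z (hx.trans hz.symm) fun _ => iff_of_false hxR hzR
    have hdisj : ∀ x, Φ.index x = a → x ∉ X := fun x hx hxX => hXA hxX ((hmemA x).2 hx)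
    by_cases hyJ : Set.rangeFactorization g y ∈ J <;>
      by_cases hzJ : Set.rangeFactorization g z ∈ J
    · convert hF.subset (hF.union_mem _ hXF _ hA) using 1
      ext x
      rw [Set.mem_preimage, Set.mem_union, hmemA]
      by_cases hx : Φ.index x = a
      · by_cases hxR : x ∈ R
        · simp [hx, hxy x hx hxR, hyJ]
        · simp [hx, hxz x hx hxR, hzJ]
      · simp [hx, hxX x hx]
    · convert hin X hXF hXA using 1
      ext x
      rw [Set.mem_preimage, Set.mem_union, Set.mem_inter_iff, hmemA]
      by_cases hx : Φ.index x = a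
      · by_cases hxR : x ∈ R
        · simp [hx, hxy x hx hxR, hyJ, hxR]
        · simp [hx, hxz x hx hxR, hzJ, hxR, hdisj x hx]
      · simp [hx, hxX x hx]
    · convert hout X hXF hXA using 1
      ext x
      rw [Set.mem_preimage, Set.mem_union, Set.mem_sdiff, hmemA]
      by_cases hx : Φ.index x = a
      · by_cases hxR : x ∈ R
        · simp [hx, hxy x hx hxR, hyJ, hxR, hdisj x hx]
        · simp [hx, hxz x hx hxR, hzJ, hxR]
      · simp [hx, hxX x hx]
    · convert hF.subset hXF using 1
      ext x
      rw [Set.mem_preimage]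
      by_cases hx : Φ.index x = a
      · by_cases hxR : x ∈ R
        · simp [hxy x hx hxR, hyJ, hdisj x hx]
        · simp [hxz x hx hxR, hzJ, hdisj x hx]
      · simp [hxX x hx]
  have hΨ : Ψ.IsStrongPseudoAnemone lam k := by
    have : ∀ J : Set Ψ.Idx, lam (Ψ.unionOf J) < (k : ℕ∞) := fun J => by
      have e : Ψ.unionOf J = (Set.rangeFactorization g) ⁻¹' J := 
        unionOf_ofSurjective (Set.rangeFactorization g) Set.rangeFactorization_surjective J
      rw [e]
      exact hunion J
    exact ⟨fun J _ => this J, this⟩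
  have hle : Φ.LeA Ψ := by
    rintro ⟨_, x, rfl⟩
    refine ⟨Φ.index x, fun x' hx' => Φ.mem_petal_iff.2 ?_⟩
    have : Set.rangeFactorization g x' = Set.rangeFactorization g x := hx'
    exact congrArg (fun t => t.1.1) this
  obtain ⟨i, hi⟩ := hΦ.2 Ψ hΨ hle a
  have h1 : Set.rangeFactorization g y = i := hi hya
  have h2 : Set.rangeFactorization g z = i := hi hza
  have h3 : (Φ.index y = a ∧ y ∈ R) = (Φ.index z = a ∧ z ∈ R) :=
    congrArg (fun t => t.1.2) (h1.trans h2.symm)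
  have h4 : Φ.index y = a ∧ y ∈ R := ⟨Φ.mem_petal_iff.1 hya, hyR⟩
  rw [h3] at h4
  exact hzR h4.2

end CyclicPartition

/-! ### Maximality of strong pseudo-anemones -/

theorem distinguishes_iff {E : Type u} {S P Q : Set (Set E)} {A : Set E}
    (hP : IsRegularProfile S P) (hQ : IsRegularProfile S Q) (hA : A ∈ S) :
    Distinguishes A P Q ↔ ¬ (A ∈ P ↔ A ∈ Q) := by
  rw [Distinguishes, hP.compl_mem_iff hA, hQ.compl_mem_iff hA]
  tauto

theorem isMaximalIn_precA_of_isMaximalIn_leA {E : Type u} {lam : Set E → ℕ∞}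
    (hlam : IsConnectivity lam) {k : ℕ} (hk : 1 ≤ k) {Prf : Set (Set (Set E))}
    (hprof : ∀ P ∈ Prf, IsProfile lam k P)
    (htrunc : ∀ P ∈ Prf, ∀ Q ∈ Prf, truncation lam (k - 1) P = truncation lam (k - 1) Q)
    {Φ : CyclicPartition E}
    (hΦ : IsMaximalIn (CyclicPartition.IsStrongPseudoAnemone lam k) CyclicPartition.LeA Φ)
    (hdist : Φ.DistinguishesAtLeast Prf 3) :
    IsMaximalIn (CyclicPartition.IsStrongPseudoAnemone lam k)
      (CyclicPartition.PrecA Prf) Φ := by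
  obtain ⟨m, rfl⟩ : ∃ m, k = m + 1 := ⟨k - 1, by omega⟩
  obtain ⟨pr, hpr, hdist⟩ := hdist
  have hS : ∃ X ∈ sepSystem lam (m + 1), X.Nonempty ∧ X ≠ Set.univ := by
    obtain ⟨J, -, hJ, hJ', -⟩ := hdist 0 1 (by decide)
    exact ⟨Φ.unionOf J, hΦ.1.2 J, Φ.unionOf_nonempty hJ, Φ.unionOf_ne_univ hJ'⟩
  have hfam : IsProfileFamily lam m Prf :=
    { symm := hlam.symm
      submodular := hlam.submodular
      regular := fun P hP => (hprof P hP).isRegularProfile hlam.symm hS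
      agree := fun P hP Q hQ A hA hAP => by
        have : A ∈ truncation lam (m + 1 - 1) P := ⟨hAP, hA⟩
        rw [htrunc P hP Q hQ] at this
        exact this.1 }
  refine ⟨hΦ.1, fun Ψ hΨ hΦΨ P hP Q hQ hPQ => ?_⟩
  have hF := CyclicPartition.isSetAlgebraIn_range_unionOf hΦ.1
  have hG := CyclicPartition.isSetAlgebraIn_range_unionOf hΨ
  have hiff : ∀ {Θ : CyclicPartition E}, Θ.IsStrongPseudoAnemone lam (m + 1) →
      ∀ P ∈ Prf, ∀ Q ∈ Prf, (∃ J : Set Θ.Idx, Distinguishes (Θ.unionOf J) P Q) ↔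
        ∃ A ∈ Set.range Θ.unionOf, ¬ (A ∈ P ↔ A ∈ Q) := by
    intro Θ hΘ P hP Q hQ
    rw [Set.exists_range_iff]
    exact exists_congr fun J =>
      distinguishes_iff (hfam.regular P hP) (hfam.regular Q hQ) (hΘ.2 J)
  by_contra hno
  rw [hiff hΦ.1 P hP Q hQ] at hno
  rw [hiff hΨ P hP Q hQ] at hPQ
  push Not at hno
  have hpair : ∀ a b, a ≠ b → ∃ A ∈ Set.range Φ.unionOf, ¬ (A ∈ pr a ↔ A ∈ pr b) := by
    intro a b hab
    obtain ⟨J, -, -, -, hJ⟩ := hdist a b hab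
    exact (hiff hΦ.1 _ (hpr a) _ (hpr b)).1 ⟨J, hJ⟩
  -- `P` agrees on `Φ` with at most one of the three profiles, since these differ pairwise there.
  obtain ⟨a, b, hab, ha, hb⟩ : ∃ a b, a ≠ b ∧
      (∃ A ∈ Set.range Φ.unionOf, ¬ (A ∈ P ↔ A ∈ pr a)) ∧
      ∃ A ∈ Set.range Φ.unionOf, ¬ (A ∈ P ↔ A ∈ pr b) := by
    have key : ∀ a b, a ≠ b → (∃ A ∈ Set.range Φ.unionOf, ¬ (A ∈ P ↔ A ∈ pr a)) ∨
        ∃ A ∈ Set.range Φ.unionOf, ¬ (A ∈ P ↔ A ∈ pr b) := by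
      intro a b hab
      obtain ⟨A, hA, hA'⟩ := hpair a b hab
      by_cases h : A ∈ P ↔ A ∈ pr a
      · exact Or.inr ⟨A, hA, fun h' => hA' (h.symm.trans h')⟩
      · exact Or.inl ⟨A, hA, h⟩
    rcases key 0 1 (by decide) with h0 | h1
    · rcases key 1 2 (by decide) with h1 | h2
      · exact ⟨0, 1, by decide, h0, h1⟩
      · exact ⟨0, 2, by decide, h0, h2⟩
    · rcases key 0 2 (by decide) with h0 | h2
      · exact ⟨0, 1, by decide, h0, h1⟩
      · exact ⟨1, 2, by decide, h1, h2⟩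
  obtain ⟨X₀, hX₀, R, hR, hall⟩ := hfam.exists_refinement hF hG hP hQ (hpr a) (hpr b)
    (fun P hP Q hQ h => (hiff hΨ P hP Q hQ).1 (hΦΨ P hP Q hQ ((hiff hΦ.1 P hP Q hQ).2 h)))
    hno hPQ ha hb (hpair a b hab)
  obtain ⟨A, hA, hAX₀, X, hX, hXA, hn⟩ :=
    CyclicPartition.exists_notMem_sepSystem_of_maximal hlam.symm hΦ hX₀ hR
  exact hn (hall A hA hAX₀ X hX hXA)

/-! ### Linear orders obtained from cyclic orders -/

/-- Cutting a cyclic order at a point gives a linear order. -/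
theorem exists_linearOrder_sbtw {I : Type u} [CircularOrder I] (i₀ : I) :
    ∃ _ : LinearOrder I, ∀ a b c : I, a < b → b < c → sbtw a b c := by
  classical
  let r : I → I → Prop := fun i j => (i = i₀ ∧ j ≠ i₀) ∨ sbtw i₀ i j
  have hne : ∀ {i j}, sbtw i₀ i j → j ≠ i₀ := by
    rintro i j h rfl
    exact sbtw_irrefl_left_right h
  have htrans : ∀ {i j k}, sbtw i₀ i j → sbtw i₀ j k → sbtw i₀ i k := fun h1 h2 =>
    (h1.cyclic_left.trans_left h2.cyclic_left).cyclic_right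
  have : IsStrictTotalOrder I r :=
    { irrefl := by
        rintro i (⟨rfl, h⟩ | h)
        · exact h rfl
        · exact sbtw_irrefl_right h
      trans := by
        rintro i j k (⟨rfl, h⟩ | h) (⟨rfl, h'⟩ | h')
        · exact absurd rfl h
        · exact Or.inl ⟨rfl, hne h'⟩
        · exact absurd rfl (hne h)
        · exact Or.inr (htrans h h')
      trichotomous := by
        intro i j h1 h2
        by_contra hij
        simp only [r, not_or, not_and, not_not] at h1 h2
        have hi : i ≠ i₀ := fun h => hij (h.trans (h1.1 h).symm)
        have hj : j ≠ i₀ := fun h => hij ((h2.1 h).trans h.symm)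
        have b1 := btw_iff_not_sbtw.2 h1.2
        have b2 := (btw_iff_not_sbtw.2 h2.2).cyclic_right
        rcases b1.antisymm b2 with h | h | h
        · exact hij h.symm
        · exact hi h
        · exact hj h.symm }
  refine ⟨linearOrderOfSTO r, fun a b c hab hbc => ?_⟩
  change r a b at hab
  change r b c at hbc
  rcases hab with ⟨rfl, h⟩ | h
  · rcases hbc with ⟨rfl, h'⟩ | h'
    · exact absurd rfl h
    · exact h'
  · rcases hbc with ⟨rfl, h'⟩ | h'
    · exact absurd rfl (hne h)
    · exact (h'.cyclic_right.trans_left h).cyclic_left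

/-- Otherwise there are points `a < u < v < w` alternately inside and outside `J`, and neither arc
between `a` and `v` avoids the complement of `J`. -/
theorem IsCyclicInterval.ordConnected_or {I : Type u} [CircularOrder I] [LinearOrder I]
    (hI : ∀ a b c : I, a < b → b < c → sbtw a b c) {J : Set I} (hJ : IsCyclicInterval J) :
    J.OrdConnected ∨ Jᶜ.OrdConnected := by
  by_contra! hno
  obtain ⟨h1, h2⟩ := hno
  obtain ⟨a, ha, c, hc, -, h1⟩ : ∃ a ∈ J, ∃ c ∈ J, a < c ∧ ¬ Set.Ioo a c ⊆ J := by
    by_contra! h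
    exact h1 (Set.ordConnected_of_Ioo h)
  obtain ⟨u, hu, w, hw, -, h2⟩ : ∃ u ∈ Jᶜ, ∃ w ∈ Jᶜ, u < w ∧ ¬ Set.Ioo u w ⊆ Jᶜ := by
    by_contra! h
    exact h2 (Set.ordConnected_of_Ioo h)
  obtain ⟨b, ⟨hab, hbc⟩, hb⟩ := Set.not_subset.1 h1
  obtain ⟨v, ⟨huv, hvw⟩, hv⟩ := Set.not_subset.1 h2
  rw [Set.mem_compl_iff, not_not] at hv
  have hca : Set.cIoo c a ⊆ J := (hJ a ha c hc).resolve_left fun h => hb (h (hI a b c hab hbc))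
  have hac := hab.trans hbc
  have hau : a < u := by
    by_contra! h
    rcases h.lt_or_eq with h | rfl
    · exact hu (hca (hI u a c h hac).cyclic_right)
    · exact hu ha
  rcases hJ a ha v hv with h | h
  · exact hu (h (hI a u v hau huv))
  · exact hw (h (hI a v w (hau.trans huv) hvw).cyclic_left)

theorem exists_strictMono_or_strictAnti_of_infinite (E : Type u) [LinearOrder E] [Infinite E] :
    ∃ x : ℕ → E, StrictMono x ∨ StrictAnti x := by
  let f := Infinite.natEmbedding E
  obtain ⟨g, hg | hg⟩ := exists_increasing_or_nonincreasing_subseq (· < ·) f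
  · exact ⟨fun n => f (g n), Or.inl fun m n h => hg m n h⟩
  · refine ⟨fun n => f (g n), Or.inr fun m n h => ?_⟩
    exact lt_of_le_of_ne (not_lt.1 (hg m n h)) fun e =>
      h.ne (g.injective (f.injective e)).symm

theorem exists_linearOrder_lex {E : Type u} {α : Type*} [LinearOrder E] [LinearOrder α] (c : E → α)
    {r : E → E → Prop} (hr : ∀ y z, r y z ↔ c y < c z ∨ c y = c z ∧ y ≤ z) :
    ∃ L : LinearOrder E, ∀ y z, L.le y z ↔ r y z :=
  ⟨LinearOrder.lift' (fun y => toLex (c y, y) : E → α ×ₗ E)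
    fun _ _ h => congrArg Prod.snd (toLex.injective h),
    fun y z => Prod.Lex.toLex_le_toLex.trans (hr y z).symm⟩

/-- The ground set of a cyclic partition can be ordered linearly such that the unions of intervals
of petals are convex or have a convex complement. -/
theorem CyclicPartition.exists_linearOrder_ordConnected {E : Type u} [Infinite E]
    (Φ : CyclicPartition E) :
    ∃ _ : LinearOrder E, (∀ J : Set Φ.Idx, IsCyclicInterval J →
      (Φ.unionOf J).OrdConnected ∨ (Φ.unionOf J)ᶜ.OrdConnected) ∧
        ∃ x : ℕ → E, StrictMono x := by
  classical
  obtain ⟨a⟩ : Nonempty E := inferInstance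
  obtain ⟨o, ho⟩ := exists_linearOrder_sbtw (Φ.index a)
  have hmono : ∃ L : LinearOrder E, ∀ y z, L.le y z → Φ.index y ≤ Φ.index z := by
    let w : LinearOrder E := linearOrderOfSTO WellOrderingRel
    obtain ⟨L, hL⟩ := exists_linearOrder_lex Φ.index fun y z => Iff.rfl
    exact ⟨L, fun y z h => ((hL y z).1 h).elim le_of_lt fun h => h.1.le⟩
  obtain ⟨L, hmono⟩ := hmono
  have hconn : ∀ J : Set Φ.Idx, J.OrdConnected → @Set.OrdConnected E L.toPreorder (Φ.unionOf J) := by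
    intro J hJ
    refine @Set.OrdConnected.mk E L.toPreorder _ fun y hy z hz t ht => ?_
    rw [mem_unionOf] at *
    exact hJ.out hy hz ⟨hmono _ _ ht.1, hmono _ _ ht.2⟩
  have hall : ∀ J : Set Φ.Idx, IsCyclicInterval J →
      @Set.OrdConnected E L.toPreorder (Φ.unionOf J) ∨
        @Set.OrdConnected E L.toPreorder (Φ.unionOf J)ᶜ := fun J hJ => by
    rw [← unionOf_compl]
    exact (hJ.ordConnected_or ho).imp (hconn J) (hconn Jᶜ)
  obtain ⟨x, hx | hx⟩ := @exists_strictMono_or_strictAnti_of_infinite E L _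
  · exact ⟨L, hall, x, hx⟩
  -- Convexity is self-dual, so a decreasing sequence is handled by reversing the order.
  · refine ⟨@OrderDual.instLinearOrder E L, fun J hJ => ?_, x, fun m n h => hx h⟩
    have hdual : ∀ D : Set E, @Set.OrdConnected E L.toPreorder D →
        @Set.OrdConnected E (@OrderDual.instLinearOrder E L).toPreorder D := fun D hD =>
      @Set.OrdConnected.mk E (@OrderDual.instLinearOrder E L).toPreorder D
        fun y hy z hz t ht => hD.out hz hy ⟨ht.2, ht.1⟩
    exact (hall J hJ).imp (hdual _) (hdual _)

/-- Moving every second element of an increasing sequence behind the initial segment generated by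
the sequence changes every initial segment only in finitely many elements, and separates the
elements of the sequence with odd index from those with even index. -/
theorem exists_linearOrder_separating {E : Type u} [LinearOrder E] {x : ℕ → E}
    (hx : StrictMono x) :
    ∃ r : E → E → Prop, (∃ L : LinearOrder E, ∀ y z, L.le y z ↔ r y z) ∧
      (∀ D : Set E, IsLowerSet D → ∃ D' : Set E, (∀ y ∈ D', ∀ z, r z y → z ∈ D') ∧
        (symmDiff D D').Finite) ∧
      ∃ N : Set E, (∀ y ∈ N, ∀ z, r z y → z ∈ N) ∧ (∀ n, x (2 * n + 1) ∈ N) ∧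
        ∀ n, x (2 * n) ∉ N := by
  classical
  -- Class 1 holds the even terms, class 0 the rest of the initial segment generated by `x`, class 2
  -- everything beyond. The new order compares classes first.
  let c : E → ℕ := fun y =>
    if ∃ n, y = x (2 * n) then 1 else if ∃ n, y ≤ x n then 0 else 2
  have hc : ∀ y, (c y = 1 ↔ ∃ n, y = x (2 * n)) ∧ (c y ≤ 1 ↔ ∃ n, y ≤ x n) := by
    intro y
    by_cases h1 : ∃ n, y = x (2 * n)
    · have h2 : ∃ n, y ≤ x n := h1.imp' (fun n => 2 * n) fun n h => h.le
      simp [c, h1, h2]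
    · by_cases h2 : ∃ n, y ≤ x n <;> simp [c, h1, h2]
  refine ⟨fun y z => c y < c z ∨ c y = c z ∧ y ≤ z, exists_linearOrder_lex c fun _ _ => Iff.rfl,
    fun D hD => ?_, {y | c y = 0}, ?_, ?_, ?_⟩
  · by_cases hAD : ∀ y n, y ≤ x n → y ∈ D
    · refine ⟨D, fun y hy z hzy => ?_, by simp⟩
      rcases hzy with h | h
      · have : c y ≤ 2 := by simp only [c]; split_ifs <;> omega
        obtain ⟨n, hn⟩ := (hc z).2.1 (by omega)
        exact hAD z n hn
      · exact hD h.2 hy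
    · push Not at hAD
      obtain ⟨a, n, han, haD⟩ := hAD
      have hlt : ∀ y ∈ D, y < x n := fun y hy =>
        lt_of_lt_of_le (lt_of_not_ge fun h => haD (hD h hy)) han
      have hcD : ∀ y ∈ D, c y ≤ 1 := fun y hy => (hc y).2.2 ⟨n, (hlt y hy).le⟩
      -- Here `D` lies below `x n`, so dropping its even terms removes only finitely many points.
      refine ⟨{y ∈ D | c y = 0}, ?_, ?_⟩
      · rintro y ⟨hy, hy0⟩ z hzy
        rcases hzy with h | h
        · omega
        · exact ⟨hD h.2 hy, h.1.trans hy0⟩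
      · refine ((Set.finite_lt_nat n).image x).subset ?_
        rintro y (⟨hy, hy'⟩ | ⟨hy, hy'⟩)
        · have h0 : c y ≠ 0 := fun h => hy' ⟨hy, h⟩
          have := hcD y hy
          obtain ⟨m, rfl⟩ := (hc y).1.1 (by omega)
          exact ⟨2 * m, hx.lt_iff_lt.1 (hlt _ hy), rfl⟩
        · exact absurd hy.1 hy'
  · intro y hy z hzy
    have hy : c y = 0 := hy
    rcases hzy with h | h
    · omega
    · exact h.1.trans hy
  · intro n
    have h1 : c (x (2 * n + 1)) ≠ 1 := fun h => by
      obtain ⟨m, hm⟩ := (hc _).1.1 h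
      have := hx.injective hm
      omega
    have h2 := (hc (x (2 * n + 1))).2.2 ⟨_, le_rfl⟩
    change c _ = 0
    omega
  · intro n h
    have h : c (x (2 * n)) = 0 := h
    have := (hc (x (2 * n))).1.2 ⟨n, rfl⟩
    omega

theorem isCyclicInterval_of_lowerSet {T : Type u} [o : LinearOrder T] {J : Set T}
    (hJ : ∀ y ∈ J, ∀ z, z ≤ y → z ∈ J) :
    @IsCyclicInterval T (LinearOrder.toCircularOrder T) J := by
  intro y hy z hz
  have key : ∀ y z : T, z ∈ J → y ≤ z →
      @Set.cIoo T (LinearOrder.toCircularOrder T).toCircularPreorder y z ⊆ J := by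
    intro y z hz hyz t ht
    have ht : (y < t ∧ t < z) ∨ (t < z ∧ z < y) ∨ (z < y ∧ y < t) := ht
    rcases ht with h | h | h
    · exact hJ z hz t h.2.le
    · exact absurd h.2 hyz.not_gt
    · exact absurd h.1 hyz.not_gt
  rcases le_total y z with h | h
  · exact Or.inl (key y z hz h)
  · exact Or.inr (key z y hy h)

theorem isCyclicInterval_singleton {I : Type u} [CircularOrder I] (i : I) :
    IsCyclicInterval ({i} : Set I) := by
  rintro _ rfl _ rfl
  exact Or.inl fun t ht => absurd ht sbtw_irrefl_left_right

/-- Any linear order on an infinite set yields a cyclic partition into singletons that displays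
all its initial segments. -/
theorem CyclicPartition.exists_displaying {E : Type u} [Infinite E] {r : E → E → Prop}
    (hr : ∃ L : LinearOrder E, ∀ y z, L.le y z ↔ r y z) :
    ∃ Ψ : CyclicPartition E, 4 ≤ ENat.card Ψ.Idx ∧
      (∀ D : Set E, (∀ y ∈ D, ∀ z, r z y → z ∈ D) →
        ∃ J : Set Ψ.Idx, IsCyclicInterval J ∧ Ψ.unionOf J = D) ∧
      ∀ a : E, ∃ J : Set Ψ.Idx, IsCyclicInterval J ∧ Ψ.unionOf J = {a} := by
  obtain ⟨L, hL⟩ := hr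
  have hunion := unionOf_ofSurjective (id : E → E) Function.surjective_id
  refine ⟨ofSurjective id Function.surjective_id, ?_, fun D hD => ⟨D, ?_, hunion D⟩, fun a =>
    ⟨_, isCyclicInterval_singleton _, hunion {a}⟩⟩
  · exact le_top.trans_eq (ENat.card_eq_top_of_infinite (α := E)).symm
  · exact isCyclicInterval_of_lowerSet (T := E) fun y hy z hz => hD y hy z ((hL z y).1 hz)

/-! ### The connectivity function with only trivial values -/

section TrivialConnectivity

variable {E : Type u} {k : ℕ}

theorem trivialConnectivity_compl (A : Set E) :
    trivialConnectivity E k Aᶜ = trivialConnectivity E k A := by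
  simp only [trivialConnectivity, Set.compl_empty_iff, Set.compl_univ_iff, or_comm]

theorem trivialConnectivity_le (A : Set E) : trivialConnectivity E k A ≤ ((k - 1 : ℕ) : ℕ∞) := by
  rw [trivialConnectivity]
  split_ifs
  · exact zero_le
  · exact le_rfl

theorem trivialConnectivity_add_one (hk : 1 < k) {A : Set E} (hA : A.Nonempty)
    (hA' : A ≠ Set.univ) : trivialConnectivity E k A + 1 = (k : ℕ∞) := by
  rw [trivialConnectivity, if_neg (by simp [hA.ne_empty, hA'])]
  have : k - 1 + 1 = k := by omega
  exact_mod_cast this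

theorem isConnectivity_trivialConnectivity :
    IsConnectivity (trivialConnectivity E k) where
  symm := trivialConnectivity_compl
  submodular A B := by
    by_cases hA : A = ∅ ∨ A = Set.univ
    · rcases hA with rfl | rfl <;> simp [add_comm]
    by_cases hB : B = ∅ ∨ B = Set.univ
    · rcases hB with rfl | rfl <;> simp [add_comm]
    refine (add_le_add (trivialConnectivity_le _) (trivialConnectivity_le _)).trans_eq ?_
    simp only [trivialConnectivity, if_neg hA, if_neg hB]
  limit_closed n C _ _ h := by
    by_cases hn : k - 1 ≤ n
    · exact (trivialConnectivity_le _).trans (by exact_mod_cast hn)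
    have htriv : ∀ A : Set E, trivialConnectivity E k A ≤ n → A = ∅ ∨ A = Set.univ := by
      intro A hA
      by_contra hne
      rw [trivialConnectivity, if_neg hne] at hA
      exact hn (by exact_mod_cast hA)
    have : ⋃₀ C = ∅ ∨ ⋃₀ C = Set.univ := by
      by_cases hu : Set.univ ∈ C
      · exact Or.inr (Set.eq_univ_of_univ_subset (Set.subset_sUnion_of_mem hu))
      · refine Or.inl (Set.sUnion_eq_empty.2 fun A hA => ?_)
        exact (htriv A (h A hA)).resolve_right fun e => hu (e ▸ hA)
    rw [trivialConnectivity, if_pos this]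
    exact zero_le

theorem sepSystem_trivialConnectivity (hk : 1 < k) :
    sepSystem (trivialConnectivity E k) k = Set.univ := by
  refine Set.eq_univ_of_forall fun A => (trivialConnectivity_le A).trans_lt ?_
  exact_mod_cast (by omega : k - 1 < k)

theorem isAnemone_trivialConnectivity (hk : 1 < k) {Φ : CyclicPartition E}
    (hΦ : 4 ≤ ENat.card Φ.Idx) : Φ.IsAnemone (trivialConnectivity E k) k := by
  have h : ∀ (Ψ : CyclicPartition E) (J : Set Ψ.Idx), J.Nonempty → J ≠ Set.univ →
      trivialConnectivity E k (Ψ.unionOf J) + 1 = (k : ℕ∞) := fun Ψ J hJ hJ' =>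
    trivialConnectivity_add_one hk (Ψ.unionOf_nonempty hJ) (Ψ.unionOf_ne_univ hJ')
  refine ⟨⟨fun J _ => ?_, hΦ, fun J _ => h Φ J⟩, fun Ψ _ _ _ J => h Ψ J⟩
  have : Φ.unionOf J ∈ sepSystem (trivialConnectivity E k) k := by
    rw [sepSystem_trivialConnectivity hk]; trivial
  exact this

theorem isPseudoFlower_trivialConnectivity (hk : 1 < k) (Φ : CyclicPartition E) :
    Φ.IsPseudoFlower (trivialConnectivity E k) k := fun J _ => by
  have : Φ.unionOf J ∈ sepSystem (trivialConnectivity E k) k := by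
    rw [sepSystem_trivialConnectivity hk]; trivial
  exact this

theorem IsProfile.isRegularProfile_univ [Infinite E] (hk : 1 < k) {P : Set (Set E)}
    (hP : IsProfile (trivialConnectivity E k) k P) : IsRegularProfile Set.univ P := by
  have := hP.isRegularProfile trivialConnectivity_compl
  rw [sepSystem_trivialConnectivity hk] at this
  obtain ⟨a⟩ : Nonempty E := inferInstance
  exact this ⟨{a}, trivial, Set.singleton_nonempty a,
    fun h => Set.infinite_univ (h ▸ Set.finite_singleton a)⟩

/-- The sets that are not in a given ultrafilter form a profile. -/
theorem isProfile_compl_ultrafilter (hk : 1 < k) (U : Ultrafilter E) :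
    IsProfile (trivialConnectivity E k) k {A | A ∉ U} := by
  rw [IsProfile, sepSystem_trivialConnectivity hk]
  refine ⟨⟨Set.subset_univ _, fun A _ => ?_⟩, ?_, fun A hA B hB => ?_⟩
  · by_cases hA : A ∈ U
    · refine ⟨Aᶜ, ⟨Ultrafilter.compl_notMem_iff.2 hA, Or.inr rfl⟩, ?_⟩
      rintro B ⟨hB, rfl | rfl⟩
      · exact absurd hA hB
      · rfl
    · refine ⟨A, ⟨hA, Or.inl rfl⟩, ?_⟩
      rintro B ⟨hB, rfl | rfl⟩
      · rfl
      · exact absurd (Ultrafilter.compl_mem_iff_notMem.2 hA) hB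
  · rintro ⟨A, B, hA, hB, -, -, hAB⟩
    exact hB (Filter.mem_of_superset (Ultrafilter.compl_notMem_iff.1 hA) hAB.subset)
  · refine fun h => h (Ultrafilter.compl_mem_iff_notMem.2 fun hAB => ?_)
    exact (Ultrafilter.union_mem_iff.1 hAB).elim hA hB

/-- Only `∅` and `univ` have order below `k - 1`, and every profile here contains just the former.
-/
theorem truncation_trivialConnectivity_eq [Infinite E] (hk : 1 < k) {P Q : Set (Set E)}
    (hP : IsProfile (trivialConnectivity E k) k P) (hQ : IsProfile (trivialConnectivity E k) k Q) :
    truncation (trivialConnectivity E k) (k - 1) P =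
      truncation (trivialConnectivity E k) (k - 1) Q := by
  have key : ∀ R, IsProfile (trivialConnectivity E k) k R →
      truncation (trivialConnectivity E k) (k - 1) R = {∅} := by
    intro R hR
    have hreg := hR.isRegularProfile_univ hk
    have he : ∅ ∈ R := by
      rcases hreg.mem_or_compl_mem ∅ trivial with h | h
      · exact h
      · exact hreg.mono _ trivial _ h (Set.empty_subset _)
    ext A
    rw [Set.mem_singleton_iff]
    constructor
    · rintro ⟨hA, hlt⟩
      by_contra hne
      have : A ≠ Set.univ := by
        rintro rfl
        exact hreg.compl_notMem _ hA (by simpa using he)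
      rw [sepSystem, Set.mem_ofPred_eq, trivialConnectivity, if_neg (by simp [hne, this])] at hlt
      exact lt_irrefl _ hlt
    · rintro rfl
      refine ⟨he, ?_⟩
      rw [sepSystem, Set.mem_ofPred_eq, trivialConnectivity, if_pos (Or.inl rfl)]
      exact_mod_cast (by omega : 0 < k - 1)
  rw [key P hP, key Q hQ]

end TrivialConnectivity

/-! ### Improving cyclic partitions -/

theorem isSetAlgebraIn_univ {E : Type u} : IsSetAlgebraIn (Set.univ : Set (Set E)) Set.univ :=
  ⟨subset_rfl, fun _ _ => trivial, fun _ _ _ _ => trivial⟩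

namespace IsRegularProfile

variable {E : Type u} {P Q : Set (Set E)}

theorem mem_of_finite (hP : IsRegularProfile Set.univ P)
    (h : ∀ a, {a} ∈ P) {A : Set E} (hA : A.Finite) : A ∈ P := by
  induction A, hA using Set.Finite.induction_on with
  | empty =>
    rcases hP.mem_or_compl_mem ∅ trivial with h | h
    · exact h
    · exact hP.mono _ trivial _ h (Set.empty_subset _)
  | @insert a s _ _ ih => exact hP.union_mem _ (h a) _ ih trivial

theorem mem_of_symmDiff_finite (hP : IsRegularProfile Set.univ P)
    (h : ∀ a, {a} ∈ P) {A B : Set E} (hAB : (symmDiff A B).Finite) (hA : A ∈ P) : B ∈ P := by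
  refine hP.mono _ trivial _ (hP.union_mem A hA _ (hP.mem_of_finite h hAB) trivial) fun x hx => ?_
  by_cases hxA : x ∈ A
  · exact Or.inl hxA
  · exact Or.inr (Or.inr ⟨hx, hxA⟩)

theorem mem_symmDiff_iff (hP : IsRegularProfile Set.univ P)
    (h : ∀ a, {a} ∈ P) {A B : Set E} (hAB : (symmDiff A B).Finite) : A ∈ P ↔ B ∈ P :=
  ⟨hP.mem_of_symmDiff_finite h hAB, hP.mem_of_symmDiff_finite h (by rwa [symmDiff_comm])⟩

/-- A profile that is big at a point is determined by that point. -/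
theorem singleton_mem_of_distinguishes (hP : IsRegularProfile Set.univ P)
    (hQ : IsRegularProfile Set.univ Q) {D : Set E} (hD : ¬ (D ∈ P ↔ D ∈ Q)) {a : E}
    (ha : {a} ∉ P) : {a} ∈ Q := by
  by_contra haQ
  have key : ∀ R, IsRegularProfile Set.univ R → {a} ∉ R → (D ∈ R ↔ a ∉ D) := by
    intro R hR haR
    refine ⟨fun h haD => haR (hR.mono _ trivial _ h (by simpa using haD)), fun haD => ?_⟩
    refine (hR.mem_or_compl_mem D trivial).resolve_right fun h => haR ?_
    exact hR.mono _ trivial _ h (by simpa using haD)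
  exact hD ((key P hP ha).trans (key Q hQ haQ).symm)

/-- A convex set is the difference of two initial segments, and profiles that agree on both agree on
the difference. -/
theorem exists_lowerSet_of_ordConnected [LinearOrder E] (hP : IsRegularProfile Set.univ P)
    (hQ : IsRegularProfile Set.univ Q) {D : Set E} (hconn : D.OrdConnected)
    (hD : ¬ (D ∈ P ↔ D ∈ Q)) : ∃ D' : Set E, IsLowerSet D' ∧ ¬ (D' ∈ P ↔ D' ∈ Q) := by
  by_contra! hno
  set D₁ : Set E := (lowerClosure D : Set E)
  have h₁ : IsLowerSet D₁ := (lowerClosure D).lower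
  have hsub : D ⊆ D₁ := subset_lowerClosure
  have h₂ : IsLowerSet (D₁ \ D) := by
    rintro y z hzy ⟨hy, hyD⟩
    refine ⟨h₁ hzy hy, fun hz => hyD ?_⟩
    obtain ⟨d, hd, hyd⟩ := mem_lowerClosure.1 hy
    exact hconn.out hz hd ⟨hzy, hyd⟩
  have e : D = D₁ \ (D₁ \ D) := by rw [Set.sdiff_sdiff_cancel_left hsub]
  have a1 := hno _ h₁
  have a2 := hno _ h₂
  have b1 := isSetAlgebraIn_univ.diff_iff hP (A := D₁) (B := D₁ \ D) trivial trivial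
  have b2 := isSetAlgebraIn_univ.diff_iff hQ (A := D₁) (B := D₁ \ D) trivial trivial
  rw [← e] at b1 b2
  tauto

end IsRegularProfile

theorem Set.OrdConnected.eventually_mem_or {E : Type u} [LinearOrder E] {D : Set E}
    (hD : D.OrdConnected) {x : ℕ → E} (hx : StrictMono x) :
    (∀ᶠ n in Filter.atTop, x n ∈ D) ∨ ∀ᶠ n in Filter.atTop, x n ∉ D := by
  by_contra! hno
  obtain ⟨h1, h2⟩ := hno
  obtain ⟨a, -, ha⟩ := Filter.frequently_atTop.1 h2 0
  obtain ⟨b, hab, hb⟩ := Filter.frequently_atTop.1 h1 a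
  obtain ⟨c, hbc, hc⟩ := Filter.frequently_atTop.1 h2 b
  exact hb (hD.out ha hc ⟨hx.monotone hab, hx.monotone hbc⟩)

/-- For the trivial connectivity function, every cyclic partition of an infinite set is strictly
below a cyclic partition into singletons. -/
theorem CyclicPartition.exists_prec_not_prec {E : Type u} [Infinite E] {k : ℕ} (hk : 1 < k)
    (Φ : CyclicPartition E) :
    ∃ Ψ : CyclicPartition E, 4 ≤ ENat.card Ψ.Idx ∧
      Prec {P | IsProfile (trivialConnectivity E k) k P} Φ Ψ ∧
      ¬ Prec {P | IsProfile (trivialConnectivity E k) k P} Ψ Φ := by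
  obtain ⟨o, ho, x, hx⟩ := Φ.exists_linearOrder_ordConnected
  obtain ⟨r, hr, hfinite, N, hN, hodd, heven⟩ := exists_linearOrder_separating hx
  obtain ⟨Ψ, hcard, hlower, hsingle⟩ := exists_displaying hr
  refine ⟨Ψ, hcard, fun P hP Q hQ => ?_, fun hprec => ?_⟩
  · rintro ⟨J, hJ, hdist⟩
    have rP := hP.isRegularProfile_univ hk
    have rQ := hQ.isRegularProfile_univ hk
    rw [distinguishes_iff rP rQ trivial] at hdist
    have key : ∀ D : Set E, ¬ (D ∈ P ↔ D ∈ Q) →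
        (∃ J : Set Ψ.Idx, IsCyclicInterval J ∧ Ψ.unionOf J = D) →
        ∃ J : Set Ψ.Idx, IsCyclicInterval J ∧ Distinguishes (Ψ.unionOf J) P Q := by
      rintro _ h ⟨J, hJ, rfl⟩
      exact ⟨J, hJ, (distinguishes_iff rP rQ trivial).2 h⟩
    -- If all singletons are small in both profiles, finite changes do not matter and an initial
    -- segment of the old order can be replaced by one of the new. Otherwise a singleton
    -- distinguishes them.
    by_cases hPp : ∀ a, {a} ∈ P
    · by_cases hQp : ∀ a, {a} ∈ Q
      · obtain ⟨D, hD, hDdist⟩ : ∃ D : Set E, IsLowerSet D ∧ ¬ (D ∈ P ↔ D ∈ Q) := by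
          rcases ho J hJ with h | h
          · exact rP.exists_lowerSet_of_ordConnected rQ h hdist
          · refine rP.exists_lowerSet_of_ordConnected rQ h ?_
            rwa [rP.compl_mem_iff trivial, rQ.compl_mem_iff trivial, not_iff_not]
        obtain ⟨D', hD', hfin⟩ := hfinite D hD
        refine key D' ?_ (hlower D' hD')
        rwa [← rP.mem_symmDiff_iff hPp hfin, ← rQ.mem_symmDiff_iff hQp hfin]
      · push Not at hQp
        obtain ⟨a, ha⟩ := hQp
        have := rQ.singleton_mem_of_distinguishes rP (fun h => hdist h.symm) ha
        exact key {a} (by tauto) (hsingle a)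
    · push Not at hPp
      obtain ⟨a, ha⟩ := hPp
      have := rP.singleton_mem_of_distinguishes rQ hdist ha
      exact key {a} (by tauto) (hsingle a)
  -- `U` lives on the odd and `V` on the even terms. A convex set contains almost all or almost no
  -- terms of `x`, so it cannot separate them, whereas `N` does.
  · let U : Ultrafilter E := (Filter.hyperfilter ℕ).map fun n => x (2 * n + 1)
    let V : Ultrafilter E := (Filter.hyperfilter ℕ).map fun n => x (2 * n)
    have hU : ∀ A : Set E, (∀ᶠ n in Filter.atTop, x n ∈ A) → A ∈ U := fun A hA => by
      have : ∀ᶠ n in Filter.atTop, x (2 * n + 1) ∈ A :=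
        (Filter.tendsto_atTop_mono (fun n => by simp only [id]; omega) Filter.tendsto_id :
          Filter.Tendsto (fun n : ℕ => 2 * n + 1) Filter.atTop Filter.atTop).eventually hA
      rw [← Nat.cofinite_eq_atTop] at this
      exact Filter.hyperfilter_le_cofinite this
    have hV : ∀ A : Set E, (∀ᶠ n in Filter.atTop, x n ∈ A) → A ∈ V := fun A hA => by
      have : ∀ᶠ n in Filter.atTop, x (2 * n) ∈ A :=
        (Filter.tendsto_atTop_mono (fun n => by simp only [id]; omega) Filter.tendsto_id :
          Filter.Tendsto (fun n : ℕ => 2 * n) Filter.atTop Filter.atTop).eventually hA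
      rw [← Nat.cofinite_eq_atTop] at this
      exact Filter.hyperfilter_le_cofinite this
    have hUV : ∀ A : Set E, A.OrdConnected → (A ∈ U ↔ A ∈ V) := fun A hA => by
      rcases hA.eventually_mem_or hx with h | h
      · exact iff_of_true (hU A h) (hV A h)
      · exact iff_of_false (Ultrafilter.compl_mem_iff_notMem.1 (hU Aᶜ h))
          (Ultrafilter.compl_mem_iff_notMem.1 (hV Aᶜ h))
    have hPU := isProfile_compl_ultrafilter hk U
    have hPV := isProfile_compl_ultrafilter hk V
    have rU := hPU.isRegularProfile_univ hk
    have rV := hPV.isRegularProfile_univ hk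
    have hNU : N ∈ U := Filter.mem_map.2 (Filter.univ_mem' hodd)
    have hNV : N ∉ V := Ultrafilter.compl_mem_iff_notMem.1 (Filter.mem_map.2
      (Filter.univ_mem' heven))
    obtain ⟨K, hK, hKN⟩ := hlower N hN
    obtain ⟨J, hJ, hdist⟩ := hprec _ hPU _ hPV ⟨K, hK, by
      rw [distinguishes_iff rU rV trivial, hKN]
      simp [hNU, hNV]⟩
    rw [distinguishes_iff rU rV trivial, Set.mem_ofPred_eq, Set.mem_ofPred_eq, not_iff_not] at hdist
    rcases ho J hJ with h | h
    · exact hdist (hUV _ h)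
    · have := hUV _ h
      rw [Ultrafilter.compl_mem_iff_notMem, Ultrafilter.compl_mem_iff_notMem, not_iff_not] at this
      exact hdist this

theorem mainTheorem6 :
    (∀ (E : Type u) (lam : Set E → ℕ∞), IsConnectivity lam →
      ∀ (k : ℕ), 1 ≤ k →
      ∀ (Prf : Set (Set (Set E))), (∀ P ∈ Prf, IsProfile lam k P) →
      (∀ P ∈ Prf, ∀ Q ∈ Prf, truncation lam (k - 1) P = truncation lam (k - 1) Q) →
      ∀ Φ : CyclicPartition E,
        IsMaximalIn (CyclicPartition.IsStrongPseudoAnemone lam k) CyclicPartition.LeA Φ →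
        (∃ Θ : CyclicPartition E, Θ.IsAnemone lam k ∧ Θ.IsConcatenationOf Φ) →
        Φ.DistinguishesAtLeast Prf 3 →
        IsMaximalIn (CyclicPartition.IsStrongPseudoAnemone lam k) (CyclicPartition.PrecA Prf) Φ) ∧
    (∀ (E : Type u), Infinite E → ∀ (k : ℕ), 1 < k →
      ∀ (lam : Set E → ℕ∞), lam = trivialConnectivity E k →
      ∀ (Prf : Set (Set (Set E))), Prf = {P | IsProfile lam k P} →
        IsConnectivity lam ∧
        (∀ P ∈ Prf, ∀ Q ∈ Prf, truncation lam (k - 1) P = truncation lam (k - 1) Q) ∧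
        (∃ Φ : CyclicPartition E, Φ.IsAnemone lam k) ∧
        (¬ ∃ Φ : CyclicPartition E,
          IsMaximalIn (CyclicPartition.IsAnemone lam k) (CyclicPartition.Prec Prf) Φ) ∧
        (¬ ∃ Φ : CyclicPartition E,
          IsMaximalIn (CyclicPartition.IsPseudoFlower lam k) (CyclicPartition.Prec Prf) Φ)) := by
  refine ⟨fun E lam hlam k hk Prf hprof htrunc Φ hΦ _ hdist =>
    isMaximalIn_precA_of_isMaximalIn_leA hlam hk hprof htrunc hΦ hdist, ?_⟩
  rintro E hE k hk _ rfl _ rfl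
  refine ⟨isConnectivity_trivialConnectivity,
    fun P hP Q hQ => truncation_trivialConnectivity_eq hk hP hQ, ?_, ?_, ?_⟩
  · classical
    obtain ⟨Ψ, hΨ, -⟩ := CyclicPartition.exists_displaying
      ⟨(linearOrderOfSTO WellOrderingRel : LinearOrder E), fun _ _ => Iff.rfl⟩
    exact ⟨Ψ, isAnemone_trivialConnectivity hk hΨ⟩
  · rintro ⟨Φ, -, hmax⟩
    obtain ⟨Ψ, hΨ, h1, h2⟩ := Φ.exists_prec_not_prec hk
    exact h2 (hmax Ψ (isAnemone_trivialConnectivity hk hΨ) h1)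
  · rintro ⟨Φ, -, hmax⟩
    obtain ⟨Ψ, -, h1, h2⟩ := Φ.exists_prec_not_prec hk
    exact h2 (hmax Ψ (isPseudoFlower_trivialConnectivity hk Ψ) h1)
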